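/- Let $q$ be a prime power. For a nonzero polynomial $P\in\mathbb F_q[X]$ write $|P|=q^{\deg P}$, let $\zeta_q(s)=\sum_{f}|f|^{-s}$ (sum over all monic $f\in\mathbb F_q[X]$; it equals $(1-q^{1-s})^{-1}$ for $s>1$), and let $$K=\prod_{P}\left(1-\frac1{(|P|+1)^2}\right),$$ where the product runs over all monic irreducible polynomials $P\in\mathbb F_q[X]$. For integers $d_1,d_2\ge 0$ let $\mathcal F_{(d_1,d_2)}$ be the set of polynomials $F=F_1F_2^2$ with $F_1,F_2\in\mathbb F_q[X]$ monic, square-free and coprime, $\deg F_1=d_1$ and $\deg F_2=d_2$. Let $0<\varepsilon<1$. Let $0\le \ell\le q$, let $x_1,\dots,x_\ell$ be distinct elements of $\mathbb F_q$ and let $a_1,\dots,a_\ell\in\mathbb F_q^*$. Then $$\left|\{F\in\mathcal F_{(d_1,d_2)}: F(x_i)=a_i,\ 1\le i\le \ell\}\right|=\frac{K q^{d_1+d_2}}{\zeta_q(2)^2}\left(\frac{q}{(q+2)(q-1)}\right)^{\ell}\left(1+O\left(q^{-(1-\varepsilon)d_2+\varepsilon \ell}+q^{-d_1/2+\ell}\right)\right).$$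 In particular, $$\left|\mathcal F_{(d_1,d_2)}\right|=\frac{K q^{d_1+d_2}}{\zeta_q(2)^2}\left(1+O\left(q^{-(1-\varepsilon)d_2}+q^{-d_1/2}\right)\right).$$ The implied constants depend only on $\varepsilon$; they are independent of $q$, $d_1$, $d_2$, $\ell$, the $x_i$ and the $a_i$. -/

import Mathlib

open Polynomial

/-- The norm `|P| = q ^ deg P` of a (nonzero) polynomial over the finite field `F`
with `q` elements, as a real number. -/
noncomputable def polyNorm {F : Type*} [Field F] [Fintype F] (P : F[X]) : ℝ :=
  (Fintype.card F : ℝ) ^ P.natDegree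

/-- The (incomplete) zeta function `ζ_q(s) = ∑ |f|^{-s}` of `𝔽_q[X]` at a real number `s`; the sum
runs over all monic polynomials `f`. It converges for `s > 1`, see `summable_polyZeta`. -/
noncomputable def polyZeta (F : Type*) [Field F] [Fintype F] (s : ℝ) : ℝ :=
  ∑' f : {f : F[X] // f.Monic}, polyNorm f.1 ^ (-s)

/-- The constant `K = ∏ (1 - 1 / (|P| + 1)^2)`; the product runs over all monic irreducible
polynomials `P`. It converges, see `multipliable_eulerK`. -/
noncomputable def eulerK (F : Type*) [Field F] [Fintype F] : ℝ :=
  ∏' P : {P : F[X] // P.Monic ∧ Irreducible P}, (1 - 1 / (polyNorm P.1 + 1) ^ 2)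

/-- The set `𝓕_(d₁,d₂)` of all polynomials `f = f₁ f₂ ^ 2` with `f₁`, `f₂` monic, square-free and
coprime, of degrees `d₁` and `d₂`. It is finite, see `finite_cubeFreeSet`. -/
def cubeFreeSet (F : Type*) [Field F] (d₁ d₂ : ℕ) : Set F[X] :=
  {f | ∃ f₁ f₂ : F[X], f₁.Monic ∧ f₂.Monic ∧ Squarefree f₁ ∧ Squarefree f₂ ∧ IsCoprime f₁ f₂ ∧
    f₁.natDegree = d₁ ∧ f₂.natDegree = d₂ ∧ f = f₁ * f₂ ^ 2}

theorem finite_cubeFreeSet (F : Type*) [Field F] [Fintype F] (d₁ d₂ : ℕ) :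
    (cubeFreeSet F d₁ d₂).Finite := by
  have : Finite (degreeLT F (d₁ + 2 * d₂ + 1)) :=
    Finite.of_equiv _ (degreeLTEquiv F (d₁ + 2 * d₂ + 1)).toEquiv.symm
  refine (Set.toFinite (degreeLT F (d₁ + 2 * d₂ + 1) : Set F[X])).subset ?_
  rintro f ⟨f₁, f₂, h₁, h₂, -, -, -, rfl, rfl, rfl⟩
  rw [SetLike.mem_coe, mem_degreeLT, degree_eq_natDegree (h₁.mul (h₂.pow 2)).ne_zero,
    h₁.natDegree_mul (h₂.pow 2), h₂.natDegree_pow]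
  exact_mod_cast Nat.lt_succ_self _

theorem card_monic_natDegree (F : Type*) [Field F] [Fintype F] (n : ℕ) :
    Nat.card {f : {f : F[X] // f.Monic} // f.1.natDegree = n} = Fintype.card F ^ n := by
  have e : {f : {f : F[X] // f.Monic} // f.1.natDegree = n} ≃ (Fin n → F) :=
    (Equiv.subtypeSubtypeEquivSubtypeInter (fun f : F[X] => f.Monic)
      (fun f => f.natDegree = n)).trans
      ((monicEquivDegreeLT n).trans (degreeLTEquiv F n).toEquiv)
  rw [Nat.card_congr e]
  simp

theorem summable_polyZeta (F : Type*) [Field F] [Fintype F] {s : ℝ} (hs : 1 < s) :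
    Summable (fun f : {f : F[X] // f.Monic} => polyNorm f.1 ^ (-s)) := by
  have hq : (1 : ℝ) < Fintype.card F := by exact_mod_cast Fintype.one_lt_card
  have hq0 : (0 : ℝ) < Fintype.card F := by linarith
  let g : {f : F[X] // f.Monic} → ℕ := fun f => f.1.natDegree
  have hfin : ∀ n, Finite {f // g f = n} := fun n => by
    apply Nat.finite_of_card_ne_zero
    rw [card_monic_natDegree]
    exact pow_ne_zero _ Fintype.card_ne_zero
  rw [← (Equiv.sigmaFiberEquiv g).summable_iff, summable_sigma_of_nonneg]
  · refine ⟨fun n => ?_, ?_⟩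
    · have := hfin n
      have := Fintype.ofFinite {f // g f = n}
      exact (hasSum_fintype _).summable
    · have key : ∀ n : ℕ, ∑' f : {f // g f = n}, polyNorm f.1.1 ^ (-s)
          = ((Fintype.card F : ℝ) ^ (1 - s)) ^ n := fun n => by
        have : ∀ f : {f // g f = n}, polyNorm f.1.1 ^ (-s)
            = ((Fintype.card F : ℝ) ^ n) ^ (-s) := fun f => by
          have h : f.1.1.natDegree = n := f.2
          rw [polyNorm, h]
        rw [tsum_congr this, tsum_const, card_monic_natDegree, nsmul_eq_mul]
        push_cast
        rw [← Real.rpow_natCast, ← Real.rpow_natCast, ← Real.rpow_mul hq0.le,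
          ← Real.rpow_add hq0, ← Real.rpow_mul hq0.le]
        ring_nf
      refine (summable_geometric_of_lt_one (r := (Fintype.card F : ℝ) ^ (1 - s))
        (Real.rpow_nonneg hq0.le _)
        (Real.rpow_lt_one_of_one_lt_of_neg hq (by linarith))).congr fun n => ?_
      exact (key n).symm
  · intro x
    exact Real.rpow_nonneg (pow_nonneg hq0.le _) _

theorem multipliable_eulerK (F : Type*) [Field F] [Fintype F] :
    Multipliable (fun P : {P : F[X] // P.Monic ∧ Irreducible P} =>
      (1 - 1 / (polyNorm P.1 + 1) ^ 2 : ℝ)) := by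
  have h0 : ∀ P : F[X], 0 < polyNorm P := fun P =>
    pow_pos (by exact_mod_cast Fintype.card_pos) _
  have hinj : Function.Injective (fun P : {P : F[X] // P.Monic ∧ Irreducible P} =>
      (⟨P.1, P.2.1⟩ : {f : F[X] // f.Monic})) := fun P Q h => by
    have := congrArg Subtype.val h
    exact Subtype.ext this
  have h := (summable_polyZeta F (s := 2) (by norm_num)).comp_injective hinj
  simp only [sub_eq_add_neg]
  refine Real.multipliable_one_add_of_summable (Summable.neg ?_)
  refine Summable.of_nonneg_of_le (fun P => by positivity) (fun P => ?_) h
  have := h0 P.1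
  simp only [Function.comp]
  rw [Real.rpow_neg this.le, Real.rpow_two, one_div]
  gcongr
  linarith

/-! Write `F = f g²` and fix `g`. The conditions on `F` say that `g` vanishes at no `x i` and that
`f` is square-free, coprime to `g` and takes the values `a i / g(x i)²`. So `f` is counted by a
sieve, and the result is summed over `g`.

Sieve for `f`. Each prime `P` contributes one modulus: `P` if `P ∣ g`, otherwise `P²`. The primes `X
- x i` need no sieving, as `f` is nonzero there. Interpolation counts monic `f` of degree `n` with
`l` prescribed values exactly when `n ≥ l`, and with error at most `min 1 (q^n)` always. Passing to
multiples of a modulus only changes the values and lowers the degree. The errors then add up over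
square-free products of moduli, to `O(q^(d₁/2))` on average over `g`, hence `O(q^(d₂ + d₁/2))` in
total (`abs_card_sieve_sub_le`, `sum_powerset_min_le`, `sum_sum_divisors_le`).

Sum over `g`. The main term depends on `g` through the weight `|P|/(|P|+1)` for each `P ∣ g`,
replaced by `0` at the points to force `g(x i) ≠ 0`. Sums of such weights over square-free `g` are
evaluated by inserting one prime at a time; instead of complex analysis, a recursion in the degree
controls the error by `q^(θ d₂)` times an Euler product (`abs_weightedSum_sub_le`).

All estimates hold for every large finite set `S` of primes with errors independent of `S`, so
letting `S` grow turns the finite products into `K` and `1/ζ(2)` (`tendsto_localDensities`).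
Uniformity in `q` and `l` uses `l ≤ q`, which also bounds the normalised main term below by an
absolute constant. -/

/-- The type of monic irreducible polynomials. -/
abbrev PrimePoly (F : Type*) [Field F] := {P : F[X] // P.Monic ∧ Irreducible P}

/-! ### Monic polynomials of given degree -/

section Monics
variable {F : Type*} [Field F] [Fintype F]

theorem finite_monic_natDegree (n : ℤ) : {f : F[X] | f.Monic ∧ (f.natDegree : ℤ) = n}.Finite := by
  rcases lt_or_ge n 0 with hn | hn
  · convert Set.finite_empty (α := F[X])
    ext f
    simp only [Set.mem_ofPred_eq, Set.mem_empty_iff_false, iff_false, not_and]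
    intro _; omega
  · lift n to ℕ using hn
    have : Finite {f : {f : F[X] // f.Monic} // f.1.natDegree = n} :=
      Nat.finite_of_card_ne_zero (by rw [card_monic_natDegree]; exact pow_ne_zero _ Fintype.card_ne_zero)
    refine (Set.finite_range
      (fun f : {f : {f : F[X] // f.Monic} // f.1.natDegree = n} => f.1.1)).subset ?_
    rintro f ⟨h1, h2⟩
    exact ⟨⟨⟨f, h1⟩, by exact_mod_cast h2⟩, rfl⟩

variable (F) in
/-- The finite set of monic polynomials of degree `n` (empty for negative `n`). -/
noncomputable def monics (n : ℤ) : Finset F[X] := (finite_monic_natDegree (F := F) n).toFinset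

@[simp] theorem mem_monics {n : ℤ} {f : F[X]} :
    f ∈ monics F n ↔ f.Monic ∧ (f.natDegree : ℤ) = n := by simp [monics]

theorem monics_of_neg {n : ℤ} (hn : n < 0) : monics F n = ∅ := by
  ext f
  simp only [mem_monics, Finset.notMem_empty, iff_false, not_and]
  intro _; omega

theorem card_monics (n : ℕ) : (monics F n).card = Fintype.card F ^ n := by
  rw [← card_monic_natDegree F n, ← Nat.card_eq_finsetCard]
  exact Nat.card_congr
    { toFun := fun f => ⟨⟨f.1, (mem_monics.1 f.2).1⟩, by exact_mod_cast (mem_monics.1 f.2).2⟩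
      invFun := fun f => ⟨f.1.1, mem_monics.2 ⟨f.1.2, by exact_mod_cast f.2⟩⟩
      left_inv := fun _ => rfl
      right_inv := fun _ => rfl }

open Classical in
theorem sum_monics_filter_dvd {w : F[X]} (hw : w.Monic) (n : ℤ) (φ : F[X] → ℝ) :
    ∑ f ∈ monics F n with w ∣ f, φ f = ∑ g ∈ monics F (n - w.natDegree), φ (w * g) := by
  symm
  refine Finset.sum_bij (fun g _ => w * g) ?_ ?_ ?_ ?_
  · intro g hg
    rw [mem_monics] at hg
    simp only [Finset.mem_filter, mem_monics, dvd_mul_right, and_true]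
    refine ⟨hw.mul hg.1, ?_⟩
    rw [hw.natDegree_mul hg.1]; push_cast; omega
  · intro a _ b _ h
    exact mul_left_cancel₀ hw.ne_zero h
  · intro f hf
    simp only [Finset.mem_filter, mem_monics] at hf
    obtain ⟨⟨h1, h2⟩, g, rfl⟩ := hf
    have hg := hw.of_mul_monic_left h1
    rw [hw.natDegree_mul hg] at h2
    exact ⟨g, by rw [mem_monics]; exact ⟨hg, by push_cast at h2; omega⟩, rfl⟩
  · intros; rfl

theorem one_lt_cardR : (1 : ℝ) < Fintype.card F := by exact_mod_cast Fintype.one_lt_card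

theorem two_le_cardR : (2 : ℝ) ≤ Fintype.card F := by exact_mod_cast Fintype.one_lt_card

theorem cardR_pos : (0 : ℝ) < Fintype.card F := by exact_mod_cast Fintype.card_pos

theorem polyNorm_pos (P : F[X]) : 0 < polyNorm P := pow_pos cardR_pos _

theorem two_le_polyNorm (P : PrimePoly F) : 2 ≤ polyNorm P.1 :=
  two_le_cardR.trans (le_self_pow₀ one_lt_cardR.le P.2.2.natDegree_pos.ne')

theorem polyNorm_eq_zpow (P : F[X]) : polyNorm P = (Fintype.card F : ℝ) ^ (P.natDegree : ℤ) := by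
  simp [polyNorm]

end Monics

/-! ### Unique decomposition into a square times a square-free part -/

section SquareDecomposition
variable {F : Type*} [Field F]

/-- After division by the gcd, the cofactor `a` of `D` is coprime to that of `D'`, so `a²` divides
the square-free `G'` and `a` is a unit. -/
theorem dvd_of_sq_mul_eq {D D' G G' : F[X]} (hD' : D' ≠ 0) (hG' : Squarefree G')
    (h : D ^ 2 * G = D' ^ 2 * G') : D ∣ D' := by
  classical
  let g := gcd D D'
  obtain ⟨a, b, hab, ha, hb⟩ : ∃ a b, IsCoprime a b ∧ D = g * a ∧ D' = g * b := by
    have hg : g ≠ 0 := fun h => hD' ((gcd_eq_zero_iff _ _).1 h).2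
    exact ⟨D / g, D' / g, isCoprime_div_gcd_div_gcd hD',
      (EuclideanDomain.mul_div_cancel' hg (gcd_dvd_left D D')).symm,
      (EuclideanDomain.mul_div_cancel' hg (gcd_dvd_right D D')).symm⟩
  have hg : g ≠ 0 := by rintro hg; rw [hg, zero_mul] at hb; exact hD' hb
  have h2 : a ^ 2 * G = b ^ 2 * G' := by
    rw [ha, hb] at h
    have : g ^ 2 * (a ^ 2 * G) = g ^ 2 * (b ^ 2 * G') := by linear_combination h
    exact mul_left_cancel₀ (pow_ne_zero 2 hg) this
  have h3 : a * a ∣ G' := by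
    rw [← sq]
    exact (hab.pow (m := 2) (n := 2)).dvd_of_dvd_mul_left ⟨G, h2.symm⟩
  have := hG' a h3
  rw [ha, hb]
  exact mul_dvd_mul_left _ this.dvd

theorem sq_mul_squarefree_unique {D D' G G' : F[X]} (hD : D.Monic) (hD' : D'.Monic)
    (hG : Squarefree G) (hG' : Squarefree G') (h : D ^ 2 * G = D' ^ 2 * G') : D = D' ∧ G = G' := by
  have : D = D' := eq_of_monic_of_associated hD hD'
    (associated_of_dvd_dvd (dvd_of_sq_mul_eq hD'.ne_zero hG' h) (dvd_of_sq_mul_eq hD.ne_zero hG h.symm))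
  subst this
  exact ⟨rfl, mul_left_cancel₀ (pow_ne_zero 2 hD.ne_zero) h⟩

theorem exists_sq_mul_squarefree {f : F[X]} (hf : f.Monic) :
    ∃ D G : F[X], D.Monic ∧ G.Monic ∧ Squarefree G ∧ f = D ^ 2 * G := by
  induction hn : f.natDegree using Nat.strong_induction_on generalizing f with
  | _ n ih =>
  by_cases hs : Squarefree f
  · exact ⟨1, f, monic_one, hf, hs, by simp⟩
  · simp only [Squarefree, not_forall] at hs
    obtain ⟨x, ⟨k, hx⟩, hu⟩ := hs
    have hx0 : x ≠ 0 := by rintro rfl; exact hf.ne_zero (by simpa using hx)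
    have hk0 : k ≠ 0 := by rintro rfl; exact hf.ne_zero (by simpa using hx)
    have hk : k.leadingCoeff * x.leadingCoeff ^ 2 = 1 := by
      have := congrArg leadingCoeff hx
      rw [hf.leadingCoeff, leadingCoeff_mul, leadingCoeff_mul] at this
      rw [this]; ring
    have hl := leadingCoeff_ne_zero.2 hx0
    have hxm : (x * C x.leadingCoeff⁻¹).Monic := monic_mul_leadingCoeff_inv hx0
    set y := x * C x.leadingCoeff⁻¹ with hy
    have hfy : f = y * y * (C (x.leadingCoeff ^ 2) * k) := by
      rw [hx, hy]
      have : C x.leadingCoeff⁻¹ * C x.leadingCoeff⁻¹ * C (x.leadingCoeff ^ 2) = 1 := by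
        rw [← C_mul, ← C_mul, ← C_1]; congr 1; field_simp
      linear_combination (-(x * x * k)) * this
    have hkm : (C (x.leadingCoeff ^ 2) * k).Monic := (hxm.mul hxm).of_mul_monic_left (hfy ▸ hf)
    have hd : 0 < y.natDegree := by
      rw [Nat.pos_iff_ne_zero]
      intro h0
      have := hxm.natDegree_eq_zero.1 h0
      exact hu (IsUnit.of_mul_eq_one _ (hy.symm.trans this))
    obtain ⟨D, G, hD, hG, hGs, he⟩ := ih _ (by
      rw [← hn, hfy, (hxm.mul hxm).natDegree_mul hkm, hxm.natDegree_mul hxm]; omega) hkm rfl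
    exact ⟨y * D, G, hxm.mul hD, hG, hGs, by rw [hfy, he]; ring⟩

end SquareDecomposition

/-! ### Counting square-free polynomials -/

section SquarefreeCount
variable {F : Type*} [Field F] [Fintype F]

variable (F) in
open Classical in
/-- The finite set of square-free monic polynomials of degree `n`. -/
noncomputable def sqfreeMonics (n : ℤ) : Finset F[X] := {f ∈ monics F n | Squarefree f}

theorem mem_sqfreeMonics {n : ℤ} {f : F[X]} :
    f ∈ sqfreeMonics F n ↔ (f.Monic ∧ (f.natDegree : ℤ) = n) ∧ Squarefree f := by
  simp [sqfreeMonics]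

theorem sqfreeMonics_of_neg {n : ℤ} (hn : n < 0) : sqfreeMonics F n = ∅ := by
  simp [sqfreeMonics, monics_of_neg hn]

/-- Sort by the square part `D` in `f = D² G`. Terms with `2k > n` are harmless: they count
polynomials of negative degree. -/
theorem card_monics_eq_sum (n : ℕ) :
    (monics F n).card = ∑ k ∈ Finset.range (n + 1),
      (monics F k).card * (sqfreeMonics F (n - 2 * k)).card := by
  classical
  simp_rw [← Finset.card_product]
  rw [← Finset.card_sigma]
  symm
  refine Finset.card_bij (fun a _ => a.2.1 ^ 2 * a.2.2) ?_ ?_ ?_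
  · rintro ⟨k, D, G⟩ h
    simp only [Finset.mem_sigma, Finset.mem_product, mem_monics, mem_sqfreeMonics] at h ⊢
    obtain ⟨-, ⟨hD, hk⟩, ⟨hG, hn⟩, -⟩ := h
    refine ⟨(hD.pow 2).mul hG, ?_⟩
    rw [(hD.pow 2).natDegree_mul hG, hD.natDegree_pow]; push_cast; omega
  · rintro ⟨k, D, G⟩ h ⟨k', D', G'⟩ h' he
    simp only [Finset.mem_sigma, Finset.mem_product, mem_monics, mem_sqfreeMonics] at h h' he
    obtain ⟨-, ⟨hD, hk⟩, ⟨hG, hn⟩, hs⟩ := h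
    obtain ⟨-, ⟨hD', hk'⟩, ⟨hG', hn'⟩, hs'⟩ := h'
    obtain ⟨rfl, rfl⟩ := sq_mul_squarefree_unique hD hD' hs hs' he
    obtain rfl : k = k' := by omega
    rfl
  · intro f hf
    rw [mem_monics] at hf
    obtain ⟨D, G, hD, hG, hs, rfl⟩ := exists_sq_mul_squarefree hf.1
    have h2 := hf.2
    rw [(hD.pow 2).natDegree_mul hG, hD.natDegree_pow] at h2
    push_cast at h2
    refine ⟨⟨D.natDegree, D, G⟩, ?_, rfl⟩
    simp only [Finset.mem_sigma, Finset.mem_product, mem_monics, mem_sqfreeMonics, Finset.mem_range]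
    exact ⟨by omega, ⟨hD, trivial⟩, ⟨hG, by omega⟩, hs⟩

/-- In `card_monics_eq_sum` for `n + 2`, the terms with `k ≥ 1` are `q` times the whole sum for `n`.
-/
theorem card_sqfreeMonics_add (n : ℕ) :
    (sqfreeMonics F (n + 2 : ℕ)).card + Fintype.card F ^ (n + 1) = Fintype.card F ^ (n + 2) := by
  have h := card_monics_eq_sum (F := F) (n + 2)
  have h0 := card_monics_eq_sum (F := F) n
  rw [Finset.sum_range_succ', Finset.sum_range_succ,
    sqfreeMonics_of_neg (n := ((n + 2 : ℕ) : ℤ) - 2 * ((n + 1 + 1 : ℕ) : ℤ)) (by push_cast; omega)] at h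
  have h1 : ∑ k ∈ Finset.range (n + 1), (monics F (k + 1 : ℕ)).card *
      (sqfreeMonics F ((n + 2 : ℕ) - 2 * (k + 1 : ℕ))).card = Fintype.card F ^ (n + 1) := by
    rw [pow_succ, ← card_monics n, h0, Finset.sum_mul]
    refine Finset.sum_congr rfl fun k _ => ?_
    rw [card_monics, card_monics, pow_succ,
      show ((n + 2 : ℕ) : ℤ) - 2 * (k + 1 : ℕ) = n - 2 * k by push_cast; ring]
    ring
  rw [h1, card_monics, card_monics] at h
  simp only [Finset.card_empty, mul_zero, add_zero, pow_zero, one_mul, Nat.cast_zero, sub_zero] at h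
  rw [h, add_comm]

theorem card_sqfreeMonics {n : ℤ} (hn : 2 ≤ n) :
    ((sqfreeMonics F n).card : ℝ) = (Fintype.card F : ℝ) ^ n * (1 - 1 / Fintype.card F) := by
  obtain ⟨k, hk⟩ := Int.eq_ofNat_of_zero_le (show 0 ≤ n - 2 by omega)
  obtain rfl : n = (k + 2 : ℕ) := by push_cast; omega
  have h := card_sqfreeMonics_add (F := F) k
  have h' : ((sqfreeMonics F (k + 2 : ℕ)).card : ℝ) + (Fintype.card F : ℝ) ^ (k + 1)
    = (Fintype.card F : ℝ) ^ (k + 2) := by exact_mod_cast h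
  have := cardR_pos (F := F)
  rw [zpow_natCast, eq_sub_of_add_eq h']
  field_simp
  ring

theorem sqfreeMonics_zero_card : (sqfreeMonics F 0).card = 1 := by
  have h := card_monics_eq_sum (F := F) 0
  rw [card_monics] at h
  simpa [show (monics F 0).card = 1 by simpa using card_monics (F := F) 0] using h.symm

theorem sqfreeMonics_one_card : (sqfreeMonics F 1).card = Fintype.card F := by
  have h := card_monics_eq_sum (F := F) 1
  rw [card_monics, Finset.sum_range_succ, Finset.sum_range_one,
    sqfreeMonics_of_neg (n := ((1 : ℕ) : ℤ) - 2 * ((1 : ℕ) : ℤ)) (by norm_num)] at h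
  simpa [show (monics F 0).card = 1 by simpa using card_monics (F := F) 0] using h.symm

theorem zpow_le_rpow_mul_of_nonpos {q θ : ℝ} (hq : 1 ≤ q) (h1 : θ ≤ 1) {n : ℤ} (hn : n ≤ 0) :
    q ^ n ≤ q ^ (θ * n) := by
  rw [← Real.rpow_intCast]
  refine Real.rpow_le_rpow_of_exponent_le hq ?_
  have : (n : ℝ) ≤ 0 := by exact_mod_cast hn
  nlinarith

/-- The error is zero for `n ≥ 2`. Negative `n` is included because this starts an induction whose
degree recursion descends below zero. -/
theorem abs_card_sqfreeMonics_sub_le {θ : ℝ} (h0 : 0 ≤ θ) (h1 : θ ≤ 1) (n : ℤ) :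
    |((sqfreeMonics F n).card : ℝ) - (Fintype.card F : ℝ) ^ n * (1 - 1 / Fintype.card F)|
      ≤ (Fintype.card F : ℝ) ^ (θ * n) := by
  have hq := one_lt_cardR (F := F)
  have hq0 := cardR_pos (F := F)
  have hi : 1 / (Fintype.card F : ℝ) ≤ 1 := by rw [div_le_one hq0]; exact hq.le
  have hi0 : 0 ≤ 1 / (Fintype.card F : ℝ) := by positivity
  rcases le_or_gt 2 n with hn | hn
  · rw [card_sqfreeMonics hn, sub_self, abs_zero]; positivity
  rcases lt_or_ge n 0 with hn0 | hn0
  · rw [sqfreeMonics_of_neg hn0, Finset.card_empty, Nat.cast_zero, zero_sub, abs_neg,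
      abs_of_nonneg (mul_nonneg (by positivity) (by linarith))]
    refine le_trans ?_ (zpow_le_rpow_mul_of_nonpos hq.le h1 hn0.le)
    exact mul_le_of_le_one_right (by positivity) (by linarith)
  obtain rfl | rfl : n = 0 ∨ n = 1 := by omega
  · rw [sqfreeMonics_zero_card]
    simpa using hi
  · rw [sqfreeMonics_one_card, zpow_one, mul_sub, mul_one_div_cancel hq0.ne']
    simpa using Real.one_le_rpow hq.le h0
end SquarefreeCount

/-! ### Prescribed values and the sieve -/

section Sieve
variable {F : Type*} [Field F] [Fintype F]

open Classical in
/-- Monic polynomials of degree `n` with prescribed values `c i` at the points `x i`. -/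
noncomputable def valuedMonics {l : ℕ} (x c : Fin l → F) (n : ℤ) : Finset F[X] :=
  {f ∈ monics F n | ∀ i, f.eval (x i) = c i}

/-- With `R` the Lagrange interpolant and `M = ∏ (X - x i)`, the solutions are `M G + R` for `G`
monic of degree `n - l`. -/
theorem card_valuedMonics_of_le {l : ℕ} {x : Fin l → F} (hx : Function.Injective x) (c : Fin l → F)
    {n : ℤ} (hn : (l : ℤ) ≤ n) :
    ((valuedMonics x c n).card : ℝ) = (Fintype.card F : ℝ) ^ (n - l) := by
  classical
  obtain ⟨k, hk⟩ := Int.eq_ofNat_of_zero_le (show 0 ≤ n - l by omega)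
  have hn' : n = k + l := by omega
  set R := Lagrange.interpolate Finset.univ x c
  have hR : R.degree < (l : WithBot ℕ) := by
    have := Lagrange.degree_interpolate_lt (s := Finset.univ) c hx.injOn
    rwa [Finset.card_univ, Fintype.card_fin] at this
  have hRe : ∀ i, R.eval (x i) = c i := fun i =>
    Lagrange.eval_interpolate_at_node c hx.injOn (Finset.mem_univ i)
  set M : F[X] := ∏ i, (X - C (x i)) with hMdef
  have hM : M.Monic := monic_prod_of_monic _ _ fun i _ => monic_X_sub_C _
  have hMd : M.natDegree = l := by
    rw [hMdef, natDegree_prod_of_monic _ _ fun i _ => monic_X_sub_C (x i)]; simp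
  have hMe : ∀ i, M.eval (x i) = 0 := fun i => by
    rw [hMdef, eval_prod]
    exact Finset.prod_eq_zero (Finset.mem_univ i) (by simp)
  have key : ∀ G : F[X], G.Monic → (M * G + R).Monic ∧ (M * G + R).natDegree = l + G.natDegree := by
    intro G hG
    have hlt : R.degree < (M * G).degree := by
      refine hR.trans_le ?_
      rw [degree_eq_natDegree (hM.mul hG).ne_zero, hM.natDegree_mul hG, hMd]
      exact_mod_cast Nat.le_add_right _ _
    refine ⟨(hM.mul hG).add_of_left hlt, ?_⟩
    rw [natDegree_add_eq_left_of_degree_lt hlt, hM.natDegree_mul hG, hMd]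
  have : (monics F k).card = (valuedMonics x c n).card := by
    refine Finset.card_bij (fun G _ => M * G + R) ?_ ?_ ?_
    · intro G hG
      rw [mem_monics] at hG
      simp only [valuedMonics, Finset.mem_filter, mem_monics]
      refine ⟨⟨(key G hG.1).1, by rw [(key G hG.1).2]; push_cast; omega⟩, fun i => ?_⟩
      simp [hMe, hRe]
    · intro a _ b _ h
      exact mul_left_cancel₀ hM.ne_zero (add_right_cancel h)
    · intro f hf
      simp only [valuedMonics, Finset.mem_filter, mem_monics] at hf
      obtain ⟨⟨hf1, hf2⟩, hf3⟩ := hf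
      have hdvd : M ∣ f - R := by
        refine Finset.prod_dvd_of_coprime ?_ ?_
        · intro i _ j _ hij
          exact isCoprime_X_sub_C_of_isUnit_sub (sub_ne_zero.2 (hx.ne hij)).isUnit
        · intro i _
          rw [dvd_iff_isRoot, IsRoot, eval_sub, hf3, hRe, sub_self]
      obtain ⟨G, hG⟩ := hdvd
      have hlt : R.degree < f.degree := by
        refine hR.trans_le ?_
        rw [degree_eq_natDegree hf1.ne_zero]
        exact_mod_cast (show (l : ℤ) ≤ f.natDegree by omega)
      have hm : (M * G).Monic := by rw [← hG]; exact hf1.sub_of_left hlt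
      have hGm := hM.of_mul_monic_left hm
      have hfe : f = M * G + R := by rw [← hG]; ring
      have hd := (key G hGm).2
      rw [← hfe] at hd
      exact ⟨G, mem_monics.2 ⟨hGm, by omega⟩, hfe.symm⟩
  rw [← this, card_monics, hn']
  simp

theorem card_valuedMonics_le_one {l : ℕ} {x : Fin l → F} (hx : Function.Injective x) (c : Fin l → F)
    {n : ℤ} (hn : n ≤ (l : ℤ)) : (valuedMonics x c n).card ≤ 1 := by
  classical
  rw [Finset.card_le_one]
  intro f hf g hg
  simp only [valuedMonics, Finset.mem_filter, mem_monics] at hf hg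
  have hd : (f - g).degree < f.degree := by
    refine degree_sub_lt_left ?_ hf.1.1.ne_zero (by rw [hf.1.1.leadingCoeff, hg.1.1.leadingCoeff])
    rw [degree_eq_natDegree hf.1.1.ne_zero, degree_eq_natDegree hg.1.1.ne_zero]
    congr 1
    have := hf.1.2; have := hg.1.2; omega
  refine eq_of_degree_sub_lt_of_eval_index_eq Finset.univ hx.injOn ?_ fun i _ => by
    rw [hf.2, hg.2]
  refine hd.trans_le ?_
  rw [degree_eq_natDegree hf.1.1.ne_zero, Finset.card_univ, Fintype.card_fin]
  exact_mod_cast (show (f.natDegree : ℤ) ≤ l by omega)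

/-- The decay `q^n` for negative `n`, where only the expected count remains, keeps the sieve error
bounded independently of the set of primes. -/
theorem abs_card_valuedMonics_sub_le {l : ℕ} {x : Fin l → F} (hx : Function.Injective x)
    (c : Fin l → F) (n : ℤ) :
    |((valuedMonics x c n).card : ℝ) - (Fintype.card F : ℝ) ^ (n - l)|
      ≤ min 1 ((Fintype.card F : ℝ) ^ n) := by
  have hq := one_lt_cardR (F := F)
  have hq0 := cardR_pos (F := F)
  rcases le_or_gt (l : ℤ) n with hn | hn
  · rw [card_valuedMonics_of_le hx c hn, sub_self, abs_zero]; positivity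
  have h1 : (Fintype.card F : ℝ) ^ (n - l) ≤ (Fintype.card F : ℝ) ^ n :=
    zpow_le_zpow_right₀ hq.le (by omega)
  have h2 : (Fintype.card F : ℝ) ^ (n - l) ≤ 1 := zpow_le_one_of_nonpos₀ hq.le (by omega)
  have h3 : 0 < (Fintype.card F : ℝ) ^ (n - l) := by positivity
  rcases lt_or_ge n 0 with hn0 | hn0
  · rw [show valuedMonics x c n = ∅ by simp [valuedMonics, monics_of_neg hn0], Finset.card_empty,
      Nat.cast_zero, zero_sub, abs_neg, abs_of_pos h3]
    exact le_min h2 h1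
  · have h4 : ((valuedMonics x c n).card : ℝ) ≤ 1 := by
      exact_mod_cast card_valuedMonics_le_one hx c hn.le
    rw [min_eq_left (one_le_zpow₀ hq.le hn0), abs_le]
    constructor <;> linarith [Nat.cast_nonneg (α := ℝ) (valuedMonics x c n).card]

open Classical in
-- Inclusion–exclusion, one modulus at a time: the multiples to be removed form a problem of the
-- same kind with lower degree and other values. This is why the induction generalises both `c` and
-- `n`.
theorem abs_card_sieve_sub_le {ι : Type*} {l : ℕ} {x : Fin l → F} (hx : Function.Injective x)
    (w : ι → F[X]) (S : Finset ι) (hw : ∀ P ∈ S, (w P).Monic)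
    (hcop : (S : Set ι).Pairwise fun P Q => IsCoprime (w P) (w Q))
    (he : ∀ P ∈ S, ∀ i, (w P).eval (x i) ≠ 0) (c : Fin l → F) (n : ℤ) :
    |(({f ∈ valuedMonics x c n | ∀ P ∈ S, ¬ w P ∣ f} : Finset F[X]).card : ℝ)
        - (Fintype.card F : ℝ) ^ (n - l) * ∏ P ∈ S, (1 - 1 / polyNorm (w P))|
      ≤ ∑ T ∈ S.powerset, min 1 ((Fintype.card F : ℝ) ^ (n - ∑ P ∈ T, ((w P).natDegree : ℤ))) := by
  induction S using Finset.induction_on generalizing c n with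
  | empty => simpa using abs_card_valuedMonics_sub_le hx c n
  | insert P S hP ih =>
    have ih' := ih (fun Q hQ => hw Q (Finset.mem_insert_of_mem hQ))
      (hcop.mono (by simp)) (fun Q hQ => he Q (Finset.mem_insert_of_mem hQ))
    have hwP := hw P (Finset.mem_insert_self _ _)
    set c' : Fin l → F := fun i => c i / (w P).eval (x i)
    have hsplit : ({f ∈ valuedMonics x c n | ∀ Q ∈ S, ¬ w Q ∣ f} : Finset F[X]).card
        = ({f ∈ valuedMonics x c n | ∀ Q ∈ insert P S, ¬ w Q ∣ f} : Finset F[X]).card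
        + ({f ∈ valuedMonics x c' (n - (w P).natDegree) | ∀ Q ∈ S, ¬ w Q ∣ f} : Finset F[X]).card := by
      rw [← Finset.card_filter_add_card_filter_not (s := {f ∈ valuedMonics x c n | ∀ Q ∈ S, ¬ w Q ∣ f})
        (fun f => ¬ w P ∣ f)]
      congr 1
      · congr 1; ext f; simp only [Finset.mem_filter, Finset.forall_mem_insert]; tauto
      · symm
        refine Finset.card_bij (fun g _ => w P * g) ?_ ?_ ?_
        · intro g hg
          simp only [valuedMonics, Finset.mem_filter, mem_monics, not_not, dvd_mul_right, and_true] at hg ⊢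
          obtain ⟨⟨⟨h1, h2⟩, h3⟩, h4⟩ := hg
          refine ⟨⟨⟨hwP.mul h1, ?_⟩, fun i => ?_⟩, fun Q hQ hd => h4 Q hQ ?_⟩
          · rw [hwP.natDegree_mul h1]; push_cast; omega
          · rw [eval_mul, h3]
            exact mul_div_cancel₀ _ (he P (Finset.mem_insert_self _ _) i)
          · refine (hcop (by simp [hQ]) (by simp) ?_).dvd_of_dvd_mul_left hd
            rintro rfl; exact hP hQ
        · intro a _ b _ h
          exact mul_left_cancel₀ hwP.ne_zero h
        · intro f hf
          simp only [valuedMonics, Finset.mem_filter, mem_monics, not_not] at hf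
          obtain ⟨⟨⟨⟨h1, h2⟩, h3⟩, h4⟩, g, rfl⟩ := hf
          have hg := hwP.of_mul_monic_left h1
          rw [hwP.natDegree_mul hg] at h2
          push_cast at h2
          refine ⟨g, ?_, rfl⟩
          simp only [valuedMonics, Finset.mem_filter, mem_monics]
          refine ⟨⟨⟨hg, by omega⟩, fun i => ?_⟩, fun Q hQ hd => h4 Q hQ (hd.mul_left _)⟩
          rw [eq_div_iff (he P (Finset.mem_insert_self _ _) i), ← h3 i, eval_mul, mul_comm]
    rw [Finset.sum_powerset_insert hP, Finset.prod_insert hP]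
    have e2 : ∑ T ∈ S.powerset, min 1 ((Fintype.card F : ℝ) ^ (n - ∑ Q ∈ insert P T, ((w Q).natDegree : ℤ)))
      = ∑ T ∈ S.powerset, min 1 ((Fintype.card F : ℝ) ^ (n - (w P).natDegree - ∑ Q ∈ T, ((w Q).natDegree : ℤ))) := by
      refine Finset.sum_congr rfl fun T hT => ?_
      rw [Finset.sum_insert (fun h => hP (Finset.mem_powerset.1 hT h)), sub_sub]
    rw [e2]
    refine le_trans (le_of_eq_of_le ?_ (abs_sub _ _)) (add_le_add (ih' c n) (ih' c' (n - (w P).natDegree)))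
    congr 1
    have h5 : ((({f ∈ valuedMonics x c n | ∀ Q ∈ S, ¬ w Q ∣ f} : Finset F[X]).card : ℕ) : ℝ)
        = ({f ∈ valuedMonics x c n | ∀ Q ∈ insert P S, ¬ w Q ∣ f} : Finset F[X]).card
        + ({f ∈ valuedMonics x c' (n - (w P).natDegree) | ∀ Q ∈ S, ¬ w Q ∣ f} : Finset F[X]).card := by
      exact_mod_cast hsplit
    rw [h5, polyNorm_eq_zpow, show n - ((w P).natDegree : ℤ) - l = (n - l) - (w P).natDegree by ring,
      zpow_sub₀ (cardR_pos (F := F)).ne' (n - l)]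
    ring

end Sieve

/-! ### A telescoping bound -/

section Bounds

/-- Along a geometric progression of ratio `q` the right-hand side telescopes. The constant `6`
gives equality at `q = 2`, `u = 1`. -/
theorem min_one_div_le {q u : ℝ} (hq : 2 ≤ q) (hu : 0 < u) :
    min u (1 / u) ≤ 6 * (q * u / (1 + q * u) - u / (1 + u)) := by
  have h : 6 * (q * u / (1 + q * u) - u / (1 + u)) = 6 * ((q - 1) * u) / ((1 + q * u) * (1 + u)) := by
    field_simp; ring
  rw [h]
  rcases le_or_gt u 1 with h1 | h1
  · refine (min_le_left _ _).trans ?_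
    rw [le_div_iff₀ (by positivity)]
    have h2 : (1 + q * u) * (1 + u) ≤ (1 + q * 1) * (1 + 1) := by gcongr
    have h3 : (1 + q * u) * (1 + u) ≤ 6 * (q - 1) := by linarith
    calc u * ((1 + q * u) * (1 + u)) ≤ u * (6 * (q - 1)) := by gcongr
      _ = _ := by ring
  · refine (min_le_right _ _).trans ?_
    rw [div_le_div_iff₀ hu (by positivity)]
    have h2 : (1 + q * u) * (1 + u) ≤ (u + q * u) * (u + u) := by gcongr
    have h3 : 0 ≤ (4 * q - 8) * (u * u) := mul_nonneg (by linarith) (by positivity)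
    nlinarith

theorem sum_pow_mul_min_le {q : ℝ} (hq : 2 ≤ q) (m : ℤ) (N : ℕ) :
    ∑ j ∈ Finset.range N, q ^ j * min 1 (q ^ (m - 2 * j)) ≤ 6 * q ^ ((m : ℝ) / 2) := by
  have hq0 : 0 < q := by linarith
  -- The terms peak at `j = m/2` and decay on both sides; `u` is centred there.
  set u : ℕ → ℝ := fun j => q ^ ((j : ℝ) - m / 2) with hu
  have hup : ∀ j, 0 < u j := fun j => by positivity
  have hus : ∀ j, u (j + 1) = q * u j := fun j => by
    simp only [hu]
    rw [show ((j + 1 : ℕ) : ℝ) - m / 2 = 1 + (j - m / 2) by push_cast; ring, Real.rpow_add hq0,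
      Real.rpow_one]
  have hterm : ∀ j : ℕ, q ^ j * min 1 (q ^ (m - 2 * j)) = q ^ ((m : ℝ) / 2) * min (u j) (1 / u j) := by
    intro j
    rw [mul_min_of_nonneg _ _ (by positivity), mul_min_of_nonneg _ _ (by positivity)]
    simp only [hu]
    congr 1
    · rw [mul_one, ← Real.rpow_add hq0, ← Real.rpow_natCast]; congr 1; ring
    · rw [one_div, ← Real.rpow_neg hq0.le, ← Real.rpow_add hq0, ← Real.rpow_natCast,
        ← Real.rpow_intCast, ← Real.rpow_add hq0]
      congr 1; push_cast; ring
  rw [Finset.sum_congr rfl fun j _ => hterm j, ← Finset.mul_sum, mul_comm (6 : ℝ)]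
  refine mul_le_mul_of_nonneg_left ?_ (by positivity)
  calc ∑ j ∈ Finset.range N, min (u j) (1 / u j)
      ≤ ∑ j ∈ Finset.range N, 6 * (u (j + 1) / (1 + u (j + 1)) - u j / (1 + u j)) :=
        Finset.sum_le_sum fun j _ => by rw [hus]; exact min_one_div_le hq (hup j)
    _ = 6 * (u N / (1 + u N) - u 0 / (1 + u 0)) := by
        rw [← Finset.mul_sum, Finset.sum_range_sub (fun j => u j / (1 + u j))]
    _ ≤ 6 := by
        have h1 : u N / (1 + u N) ≤ 1 := by
          rw [div_le_one (by linarith [hup N])]; linarith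
        have h2 : 0 ≤ u 0 / (1 + u 0) := div_nonneg (hup 0).le (by linarith [hup 0])
        linarith

end Bounds

/-! ### Sieve moduli and the total sieve error -/

section PowersetBound
variable {F : Type*} [Field F]

theorem PrimePoly.eq_of_dvd {P Q : PrimePoly F} (h : P.1 ∣ Q.1) : P = Q :=
  Subtype.ext (eq_of_monic_of_associated P.2.1 Q.2.1 (P.2.2.associated_of_dvd Q.2.2 h))

theorem PrimePoly.isCoprime {P Q : PrimePoly F} (h : P ≠ Q) : IsCoprime P.1 Q.1 :=
  (P.2.2.isCoprime_or_dvd Q.1).resolve_right fun hd => h (PrimePoly.eq_of_dvd hd)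

theorem PrimePoly.mem_of_dvd_prod {P : PrimePoly F} {T : Finset (PrimePoly F)}
    (h : P.1 ∣ ∏ Q ∈ T, Q.1) : P ∈ T := by
  obtain ⟨Q, hQ, hd⟩ := (P.2.2.prime.dvd_finsetProd_iff _).1 h
  rwa [PrimePoly.eq_of_dvd hd]

open Classical in
/-- The modulus at `P` for sieving out polynomials that are divisible by a square or not coprime
to `g`. -/
noncomputable def sieveModulus (g : F[X]) (P : PrimePoly F) : F[X] :=
  if P.1 ∣ g then P.1 else P.1 ^ 2

theorem monic_sieveModulus (g : F[X]) (P : PrimePoly F) : (sieveModulus g P).Monic := by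
  unfold sieveModulus; split_ifs
  exacts [P.2.1, P.2.1.pow 2]

theorem isCoprime_sieveModulus (g : F[X]) {P Q : PrimePoly F} (h : P ≠ Q) :
    IsCoprime (sieveModulus g P) (sieveModulus g Q) := by
  have := PrimePoly.isCoprime h
  unfold sieveModulus; split_ifs
  exacts [this, this.pow_right, this.pow_left, this.pow]

variable [Fintype F]

open Classical in
-- A set `T` of primes is determined by `e`, the product of its members dividing `g`, and `D`, the
-- product of the others; its moduli have total degree `deg e + 2 deg D`. Dropping all conditions on
-- `D` except monicity leaves the telescoping sum, and a bound free of `S`.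
theorem sum_powerset_min_le {g : F[X]} (hg : g.Monic) (S : Finset (PrimePoly F)) (n : ℤ) :
    ∑ T ∈ S.powerset, min 1 ((Fintype.card F : ℝ) ^
        (n - ∑ P ∈ T, ((sieveModulus g P).natDegree : ℤ)))
      ≤ ∑ k ∈ Finset.range (g.natDegree + 1), ∑ _e ∈ monics F k with _e ∣ g,
          6 * (Fintype.card F : ℝ) ^ (((n - k : ℤ) : ℝ) / 2) := by
  set q := (Fintype.card F : ℝ)
  set N := ∑ P ∈ S, P.1.natDegree
  let X : Finset (Σ _ : ℕ, F[X]) := (Finset.range (g.natDegree + 1)).sigma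
    fun k => {e ∈ monics F k | e ∣ g}
  let Y : Finset (Σ _ : ℕ, F[X]) := (Finset.range (N + 1)).sigma fun j => monics F j
  let φ : (Σ _ : ℕ, F[X]) × (Σ _ : ℕ, F[X]) → ℝ := fun p =>
    min 1 (q ^ (n - p.1.1 - 2 * p.2.1))
  let e : Finset (PrimePoly F) → F[X] := fun T => ∏ P ∈ T with P.1 ∣ g, P.1
  let D : Finset (PrimePoly F) → F[X] := fun T => ∏ P ∈ T with ¬ P.1 ∣ g, P.1
  let i : Finset (PrimePoly F) → (Σ _ : ℕ, F[X]) × (Σ _ : ℕ, F[X]) := fun T =>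
    (⟨(e T).natDegree, e T⟩, ⟨(D T).natDegree, D T⟩)
  have he : ∀ T, (e T).Monic := fun T => monic_prod_of_monic _ _ fun P _ => P.2.1
  have hD : ∀ T, (D T).Monic := fun T => monic_prod_of_monic _ _ fun P _ => P.2.1
  have heD : ∀ T, e T * D T = ∏ P ∈ T, P.1 := fun T => Finset.prod_filter_mul_prod_filter_not _ _ _
  have heg : ∀ T, e T ∣ g := fun T => by
    refine Finset.prod_dvd_of_coprime (fun P _ Q _ h => PrimePoly.isCoprime h) fun P hP => ?_
    exact (Finset.mem_filter.1 hP).2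
  have hinj : Function.Injective i := by
    intro T T' h
    have h1 : e T = e T' := by
      have := congrArg (fun p => p.1.2) h; exact this
    have h2 : D T = D T' := by
      have := congrArg (fun p => p.2.2) h; exact this
    have h3 : ∏ P ∈ T, P.1 = ∏ P ∈ T', P.1 := by rw [← heD, ← heD, h1, h2]
    ext P
    constructor
    · intro h; exact PrimePoly.mem_of_dvd_prod (h3 ▸ Finset.dvd_prod_of_mem (fun P : PrimePoly F => P.1) h)
    · intro h; exact PrimePoly.mem_of_dvd_prod (h3.symm ▸ Finset.dvd_prod_of_mem (fun P : PrimePoly F => P.1) h)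
  have hval : ∀ T, min 1 (q ^ (n - ∑ P ∈ T, ((sieveModulus g P).natDegree : ℤ))) = φ (i T) := by
    intro T
    simp only [φ, i]
    congr 2
    rw [sub_sub]
    congr 1
    rw [← Finset.sum_filter_add_sum_filter_not T (fun P => P.1 ∣ g)]
    simp only [e, D]
    rw [natDegree_prod_of_monic _ _ fun P _ => P.2.1, natDegree_prod_of_monic _ _ fun P _ => P.2.1]
    push_cast
    rw [Finset.mul_sum]
    congr 1
    · refine Finset.sum_congr rfl fun P hP => ?_
      rw [sieveModulus, if_pos (Finset.mem_filter.1 hP).2]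
    · refine Finset.sum_congr rfl fun P hP => ?_
      rw [sieveModulus, if_neg (Finset.mem_filter.1 hP).2, P.2.1.natDegree_pow]
      push_cast; ring
  have hmem : ∀ T ∈ S.powerset, i T ∈ X ×ˢ Y := by
    intro T hT
    simp only [i, X, Y, Finset.mem_product, Finset.mem_sigma, Finset.mem_range, Finset.mem_filter,
      mem_monics, and_true]
    refine ⟨⟨Nat.lt_succ_of_le (natDegree_le_of_dvd (heg T) hg.ne_zero), he T, heg T⟩, ?_, hD T⟩
    refine Nat.lt_succ_of_le ?_
    simp only [D]
    rw [natDegree_prod_of_monic _ _ fun P _ => P.2.1]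
    exact Finset.sum_le_sum_of_subset
      ((Finset.filter_subset _ _).trans (Finset.mem_powerset.1 hT))
  calc _ = ∑ T ∈ S.powerset, φ (i T) := Finset.sum_congr rfl fun T _ => hval T
    _ = ∑ p ∈ S.powerset.image i, φ p := (Finset.sum_image hinj.injOn).symm
    _ ≤ ∑ p ∈ X ×ˢ Y, φ p := by
        refine Finset.sum_le_sum_of_subset_of_nonneg ?_ fun p _ _ => by positivity
        intro p hp
        obtain ⟨T, hT, rfl⟩ := Finset.mem_image.1 hp
        exact hmem T hT
    _ ≤ _ := by
        rw [Finset.sum_product, Finset.sum_sigma]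
        refine Finset.sum_le_sum fun k _ => Finset.sum_le_sum fun a _ => ?_
        rw [Finset.sum_sigma]
        refine le_trans (le_of_eq ?_) (sum_pow_mul_min_le two_le_cardR (n - k) (N + 1))
        refine Finset.sum_congr rfl fun j _ => ?_
        simp [φ, card_monics, q]

open Classical in
-- Swapping sums, there are `q^d` pairs `(e, g)` for each `k`, leaving a geometric series in
-- `q^(-1/2) ≤ 3/4`; hence `24 = 6 · 4`.
theorem sum_sum_divisors_le (d : ℕ) (n : ℤ) :
    ∑ g ∈ monics F d, ∑ k ∈ Finset.range (d + 1), ∑ _e ∈ monics F k with _e ∣ g,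
          6 * (Fintype.card F : ℝ) ^ (((n - k : ℤ) : ℝ) / 2)
      ≤ 24 * (Fintype.card F : ℝ) ^ (d + (n : ℝ) / 2) := by
  have hq := two_le_cardR (F := F)
  have hq0 := cardR_pos (F := F)
  set q := (Fintype.card F : ℝ) with hqdef
  have hr : q ^ (-(1 / 2 : ℝ)) ≤ 3 / 4 := by
    rw [Real.rpow_neg hq0.le, ← Real.sqrt_eq_rpow]
    have : 4 / 3 ≤ √q := Real.le_sqrt_of_sq_le (by norm_num; linarith)
    rw [inv_le_comm₀ (by positivity) (by norm_num)]
    simpa using this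
  have hinner : ∀ k ∈ Finset.range (d + 1), ∑ g ∈ monics F d, ∑ _e ∈ monics F k with _e ∣ g,
      6 * q ^ (((n - k : ℤ) : ℝ) / 2) = 6 * q ^ (d + (n : ℝ) / 2) * (q ^ (-(1 / 2 : ℝ))) ^ k := by
    intro k hk
    have hk' : k ≤ d := Nat.lt_succ_iff.1 (Finset.mem_range.1 hk)
    simp_rw [Finset.sum_filter]
    rw [Finset.sum_comm]
    have : ∀ e ∈ monics F k, ∑ g ∈ monics F d, (if e ∣ g then 6 * q ^ (((n - k : ℤ) : ℝ) / 2) else 0)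
        = q ^ (d - k) * (6 * q ^ (((n - k : ℤ) : ℝ) / 2)) := by
      intro e he
      rw [mem_monics] at he
      rw [← Finset.sum_filter, sum_monics_filter_dvd he.1, he.2, Finset.sum_const, nsmul_eq_mul,
        ← Nat.cast_sub hk', card_monics]
      push_cast; rfl
    rw [Finset.sum_congr rfl this, Finset.sum_const, card_monics, nsmul_eq_mul]
    push_cast
    rw [← hqdef, ← mul_assoc, ← pow_add, Nat.add_sub_cancel' hk', ← Real.rpow_natCast,
      ← Real.rpow_natCast (q ^ _), ← Real.rpow_mul hq0.le, mul_left_comm, mul_assoc,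
      ← Real.rpow_add hq0, ← Real.rpow_add hq0]
    congr 2; ring
  rw [Finset.sum_comm, Finset.sum_congr rfl hinner, ← Finset.mul_sum]
  have hgeom : ∑ k ∈ Finset.range (d + 1), (q ^ (-(1 / 2 : ℝ))) ^ k ≤ 4 := by
    calc _ ≤ ∑ k ∈ Finset.range (d + 1), (3 / 4 : ℝ) ^ k := by gcongr
      _ ≤ ∑' k : ℕ, (3 / 4 : ℝ) ^ k :=
          (summable_geometric_of_lt_one (by norm_num) (by norm_num)).sum_le_tsum _
            fun _ _ => by positivity
      _ = 4 := by rw [tsum_geometric_of_lt_one (by norm_num) (by norm_num)]; norm_num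
  nlinarith [show 0 < q ^ (d + (n : ℝ) / 2) by positivity]

end PowersetBound

/-! ### Weighted sums over square-free polynomials -/

section Weighted
variable {F : Type*} [Field F]

open Classical in
/-- The weight of `f` at `P`: `g P` if `P` divides `f`, and `1` otherwise. -/
noncomputable def primeWeight (g : PrimePoly F → ℝ) (f : F[X]) (P : PrimePoly F) : ℝ :=
  if P.1 ∣ f then g P else 1

theorem primeWeight_mul {g : PrimePoly F → ℝ} {P Q : PrimePoly F} (h : Q ≠ P) (f : F[X]) :
    primeWeight g (P.1 * f) Q = primeWeight g f Q := by
  unfold primeWeight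
  congr 1
  exact propext ⟨(PrimePoly.isCoprime h).dvd_of_dvd_mul_left, fun hd => hd.mul_left _⟩

variable [Fintype F]

/-- The sum of the weights `∏_{P ∈ S, P ∣ f} g P` over square-free monic `f` of degree `n`. -/
noncomputable def weightedSum (g : PrimePoly F → ℝ) (S : Finset (PrimePoly F)) (n : ℤ) : ℝ :=
  ∑ f ∈ sqfreeMonics F n, ∏ P ∈ S, primeWeight g f P

open Classical in
/-- The part of `weightedSum` coming from multiples of `P`. -/
noncomputable def weightedSumDvd (g : PrimePoly F → ℝ) (S : Finset (PrimePoly F)) (P : PrimePoly F)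
    (n : ℤ) : ℝ :=
  ∑ f ∈ sqfreeMonics F n with P.1 ∣ f, ∏ Q ∈ S, primeWeight g f Q

/-- `P f` is square-free exactly when `f` is square-free and prime to `P`, and multiplying by `P ∉
S` leaves the weights over `S` unchanged. -/
theorem weightedSumDvd_add (g : PrimePoly F → ℝ) {S : Finset (PrimePoly F)} {P : PrimePoly F}
    (hP : P ∉ S) (n : ℤ) :
    weightedSumDvd g S P n + weightedSumDvd g S P (n - P.1.natDegree)
      = weightedSum g S (n - P.1.natDegree) := by
  classical
  have h1 : weightedSumDvd g S P n
      = ∑ f ∈ sqfreeMonics F (n - P.1.natDegree) with ¬ P.1 ∣ f, ∏ Q ∈ S, primeWeight g f Q := by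
    symm
    refine Finset.sum_bij (fun f _ => P.1 * f) ?_ ?_ ?_ ?_
    · intro f hf
      simp only [Finset.mem_filter, mem_sqfreeMonics, dvd_mul_right, and_true] at hf ⊢
      obtain ⟨⟨⟨h1, h2⟩, h3⟩, h4⟩ := hf
      refine ⟨⟨P.2.1.mul h1, ?_⟩, ?_⟩
      · rw [P.2.1.natDegree_mul h1]; push_cast; omega
      · rw [squarefree_mul_iff]
        exact ⟨((P.2.2.isCoprime_or_dvd f).resolve_right h4).isRelPrime, P.2.2.squarefree, h3⟩
    · intro a _ b _ h
      exact mul_left_cancel₀ P.2.1.ne_zero h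
    · intro f hf
      simp only [Finset.mem_filter, mem_sqfreeMonics] at hf
      obtain ⟨⟨⟨h1, h2⟩, h3⟩, k, rfl⟩ := hf
      have hk := P.2.1.of_mul_monic_left h1
      rw [P.2.1.natDegree_mul hk] at h2
      push_cast at h2
      refine ⟨k, ?_, rfl⟩
      simp only [Finset.mem_filter, mem_sqfreeMonics]
      exact ⟨⟨⟨hk, by omega⟩, h3.squarefree_of_dvd (Dvd.intro_left _ rfl)⟩,
        fun hd => P.2.2.not_isUnit (h3 _ (mul_dvd_mul_left _ hd))⟩
    · intro f _
      exact Finset.prod_congr rfl fun Q hQ =>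
        (primeWeight_mul (by rintro rfl; exact hP hQ) f).symm
  rw [h1, weightedSumDvd, weightedSum, add_comm]
  exact Finset.sum_filter_add_sum_filter_not _ _ _

theorem weightedSum_insert (g : PrimePoly F → ℝ) {S : Finset (PrimePoly F)} {P : PrimePoly F}
    [DecidableEq (PrimePoly F)] (hP : P ∉ S) (n : ℤ) :
    weightedSum g (insert P S) n = weightedSum g S n - (1 - g P) * weightedSumDvd g S P n := by
  classical
  unfold weightedSum weightedSumDvd
  rw [Finset.sum_filter, Finset.mul_sum, ← Finset.sum_sub_distrib]
  refine Finset.sum_congr rfl fun f _ => ?_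
  rw [Finset.prod_insert hP, primeWeight]
  split_ifs <;> ring

theorem weightedSumDvd_of_neg (g : PrimePoly F → ℝ) (S : Finset (PrimePoly F)) (P : PrimePoly F)
    {n : ℤ} (hn : n < 0) : weightedSumDvd g S P n = 0 := by
  simp [weightedSumDvd, sqfreeMonics_of_neg hn]

theorem polyNorm_rpow_neg_lt_one {θ : ℝ} (h0 : 0 < θ) (P : PrimePoly F) : polyNorm P.1 ^ (-θ) < 1 :=
  Real.rpow_lt_one_of_one_lt_of_neg (by linarith [two_le_polyNorm P]) (by linarith)

theorem card_rpow_sub_natDegree (θ : ℝ) (P : F[X]) (n : ℤ) :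
    (Fintype.card F : ℝ) ^ (θ * (n - P.natDegree : ℤ))
      = (Fintype.card F : ℝ) ^ (θ * n) * polyNorm P ^ (-θ) := by
  have hq0 := cardR_pos (F := F)
  rw [polyNorm, ← Real.rpow_natCast, ← Real.rpow_mul hq0.le, ← Real.rpow_add hq0]
  congr 1; push_cast; ring

/-- The recursion `weightedSumDvd_add` is solved exactly by the main term; iterated, its errors form
a geometric series in `y = |P|^(-θ)` with sum `y / (1 - y)`. -/
theorem abs_weightedSumDvd_sub_le {g : PrimePoly F → ℝ} {θ : ℝ} (h0 : 0 < θ) (h1 : θ ≤ 1)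
    {S : Finset (PrimePoly F)} {P : PrimePoly F} (hP : P ∉ S) {c B : ℝ} (hc0 : 0 ≤ c) (hcB : c ≤ B)
    (h : ∀ n : ℤ, |weightedSum g S n - (Fintype.card F : ℝ) ^ n * c|
      ≤ (Fintype.card F : ℝ) ^ (θ * n) * B) (n : ℤ) :
    |weightedSumDvd g S P n - (Fintype.card F : ℝ) ^ n * (c / (polyNorm P.1 + 1))|
      ≤ (Fintype.card F : ℝ) ^ (θ * n) * (B * (polyNorm P.1 ^ (-θ) / (1 - polyNorm P.1 ^ (-θ)))) := by
  have hq := one_lt_cardR (F := F)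
  have hq0 := cardR_pos (F := F)
  have hp := two_le_polyNorm P
  have hp0 := polyNorm_pos P.1
  have hy := polyNorm_rpow_neg_lt_one h0 P
  have hy0 : 0 < polyNorm P.1 ^ (-θ) := by positivity
  have hB : 0 ≤ B := hc0.trans hcB
  have hpd : (0 : ℤ) < P.1.natDegree := by exact_mod_cast P.2.2.natDegree_pos
  have main : ∀ m : ℕ, ∀ n : ℤ, n < m →
      |weightedSumDvd g S P n - (Fintype.card F : ℝ) ^ n * (c / (polyNorm P.1 + 1))|
      ≤ (Fintype.card F : ℝ) ^ (θ * n) * (B * (polyNorm P.1 ^ (-θ) / (1 - polyNorm P.1 ^ (-θ)))) := by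
    intro m
    induction m with
    -- For negative degree the sum is empty, so the main term itself must fit in the error; this
    -- uses `c ≤ B` and `θ ≤ 1`.
    | zero =>
      intro n hn
      have hn' : n < 0 := by simpa using hn
      rw [weightedSumDvd_of_neg _ _ _ hn', zero_sub, abs_neg, abs_of_nonneg (by positivity)]
      refine mul_le_mul (zpow_le_rpow_mul_of_nonpos hq.le h1 hn'.le) ?_ (by positivity) (by positivity)
      rw [div_eq_mul_inv]
      refine mul_le_mul hcB ?_ (by positivity) hB
      calc (polyNorm P.1 + 1)⁻¹ ≤ (polyNorm P.1)⁻¹ := by gcongr; linarith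
        _ = polyNorm P.1 ^ (-1 : ℝ) := by rw [Real.rpow_neg_one]
        _ ≤ polyNorm P.1 ^ (-θ) := Real.rpow_le_rpow_of_exponent_le (by linarith) (by linarith)
        _ ≤ _ := by
          rw [le_div_iff₀ (by linarith)]
          nlinarith
    | succ m ih =>
      intro n hn
      have e1 := weightedSumDvd_add g hP n
      have e2 := h (n - P.1.natDegree)
      have e3 := ih (n - P.1.natDegree) (by push_cast at hn; omega)
      rw [card_rpow_sub_natDegree] at e2 e3
      have e4 : (Fintype.card F : ℝ) ^ n = (Fintype.card F : ℝ) ^ (n - P.1.natDegree) * polyNorm P.1 := by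
        rw [polyNorm_eq_zpow, ← zpow_add₀ hq0.ne']; congr 1; ring
      have e5 : weightedSumDvd g S P n - (Fintype.card F : ℝ) ^ n * (c / (polyNorm P.1 + 1))
          = (weightedSum g S (n - P.1.natDegree) - (Fintype.card F : ℝ) ^ (n - P.1.natDegree) * c)
          - (weightedSumDvd g S P (n - P.1.natDegree)
            - (Fintype.card F : ℝ) ^ (n - P.1.natDegree) * (c / (polyNorm P.1 + 1))) := by
        rw [← e1, e4]; field_simp; ring
      rw [e5]
      refine (abs_sub _ _).trans ((add_le_add e2 e3).trans (le_of_eq ?_))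
      have : 1 - polyNorm P.1 ^ (-θ) ≠ 0 := by linarith
      field_simp
      ring
  exact main (n.toNat + 1) n (by have := Int.self_le_toNat n; push_cast; omega)

/-- The local factor of the error term of `weightedSum`. -/
noncomputable def errorFactor (g : PrimePoly F → ℝ) (θ : ℝ) (P : PrimePoly F) : ℝ :=
  1 + (1 - g P) * (polyNorm P.1 ^ (-θ) / (1 - polyNorm P.1 ^ (-θ)))

theorem one_le_errorFactor {g : PrimePoly F → ℝ} (hg1 : ∀ P, g P ≤ 1) {θ : ℝ} (h0 : 0 < θ)
    (P : PrimePoly F) : 1 ≤ errorFactor g θ P := by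
  have hy := polyNorm_rpow_neg_lt_one h0 P
  have hp0 := polyNorm_pos P.1
  have := mul_nonneg (sub_nonneg.2 (hg1 P)) (div_nonneg (Real.rpow_nonneg hp0.le (-θ)) (sub_nonneg.2 hy.le))
  unfold errorFactor; linarith

/-- Inserting `P` subtracts `1 - g P` times the part divisible by `P`: the main term gains its local
factor, the error bound gains `errorFactor`. -/
theorem abs_weightedSum_sub_le {g : PrimePoly F → ℝ} (hg0 : ∀ P, 0 ≤ g P) (hg1 : ∀ P, g P ≤ 1) {θ : ℝ}
    (h0 : 0 < θ) (h1 : θ ≤ 1) (S : Finset (PrimePoly F)) (n : ℤ) :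
    |weightedSum g S n - (Fintype.card F : ℝ) ^ n *
        ((1 - 1 / Fintype.card F) * ∏ P ∈ S, (1 - (1 - g P) / (polyNorm P.1 + 1)))|
      ≤ (Fintype.card F : ℝ) ^ (θ * n) * ∏ P ∈ S, errorFactor g θ P := by
  classical
  have hq := one_lt_cardR (F := F)
  have hq0 := cardR_pos (F := F)
  have hi : 1 / (Fintype.card F : ℝ) ≤ 1 := by rw [div_le_one hq0]; exact hq.le
  have hi0 : 0 ≤ 1 / (Fintype.card F : ℝ) := by positivity
  have hf0 : ∀ P, 0 ≤ 1 - (1 - g P) / (polyNorm P.1 + 1) := fun P => by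
    have := two_le_polyNorm P
    rw [sub_nonneg, div_le_one (by linarith)]; linarith [hg0 P]
  have hf1 : ∀ P, 1 - (1 - g P) / (polyNorm P.1 + 1) ≤ 1 := fun P => by
    have := polyNorm_pos P.1
    have := div_nonneg (sub_nonneg.2 (hg1 P)) (show 0 ≤ polyNorm P.1 + 1 by linarith)
    linarith
  induction S using Finset.induction_on generalizing n with
  | empty => simpa [weightedSum] using abs_card_sqfreeMonics_sub_le h0.le h1 n
  | insert P S hP ih =>
    set c := (1 - 1 / (Fintype.card F : ℝ)) * ∏ P ∈ S, (1 - (1 - g P) / (polyNorm P.1 + 1)) with hc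
    set B := ∏ P ∈ S, errorFactor g θ P with hB
    have hprod0 := Finset.prod_nonneg fun P (_ : P ∈ S) => hf0 P
    have hprod1 := Finset.prod_le_one (fun P (_ : P ∈ S) => hf0 P) fun P _ => hf1 P
    have hc0 : 0 ≤ c := mul_nonneg (by linarith) hprod0
    have hc1 : c ≤ 1 := mul_le_one₀ (by linarith) hprod0 hprod1
    have hB1 : 1 ≤ B := Finset.prod_induction _ (1 ≤ ·) (fun _ _ => one_le_mul_of_one_le_of_one_le) le_rfl
      fun P _ => one_le_errorFactor hg1 h0 P
    have key := abs_weightedSumDvd_sub_le h0 h1 hP hc0 (hc1.trans hB1) ih n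
    have hp := polyNorm_pos P.1
    rw [weightedSum_insert g hP, Finset.prod_insert hP, Finset.prod_insert hP, ← hB, errorFactor]
    have e : weightedSum g S n - (1 - g P) * weightedSumDvd g S P n - (Fintype.card F : ℝ) ^ n *
        ((1 - 1 / Fintype.card F) * ((1 - (1 - g P) / (polyNorm P.1 + 1)) *
          ∏ P ∈ S, (1 - (1 - g P) / (polyNorm P.1 + 1))))
        = (weightedSum g S n - (Fintype.card F : ℝ) ^ n * c) - (1 - g P) * (weightedSumDvd g S P n
          - (Fintype.card F : ℝ) ^ n * (c / (polyNorm P.1 + 1))) := by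
      rw [hc]; ring
    rw [e]
    refine (abs_sub _ _).trans ?_
    rw [abs_mul, abs_of_nonneg (sub_nonneg.2 (hg1 P))]
    refine (add_le_add (ih n) (mul_le_mul_of_nonneg_left key (sub_nonneg.2 (hg1 P)))).trans
      (le_of_eq ?_)
    ring

end Weighted

/-! ### The linear primes at the evaluation points -/

section PointPrimes
variable {F : Type*} [Field F]

theorem PrimePoly.toMonic_injective : Function.Injective
    (fun P : PrimePoly F => (⟨P.1, P.2.1⟩ : {f : F[X] // f.Monic})) := fun _ _ h =>
  Subtype.ext (congrArg (fun f : {f : F[X] // f.Monic} => f.1) h)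

open Classical in
/-- The linear polynomials `X - x i`. -/
noncomputable def pointPrimes {l : ℕ} (x : Fin l → F) : Finset (PrimePoly F) :=
  Finset.univ.image fun i => ⟨X - C (x i), monic_X_sub_C _, irreducible_X_sub_C _⟩

theorem mem_pointPrimes {l : ℕ} {x : Fin l → F} {P : PrimePoly F} :
    P ∈ pointPrimes x ↔ ∃ i, X - C (x i) = P.1 := by
  simp [pointPrimes, Subtype.ext_iff]

theorem card_pointPrimes {l : ℕ} {x : Fin l → F} (hx : Function.Injective x) :
    (pointPrimes x).card = l := by
  classical
  rw [pointPrimes, Finset.card_image_of_injective, Finset.card_univ, Fintype.card_fin]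
  intro i j h
  have := congrArg (fun P : PrimePoly F => P.1) h
  exact hx (C_injective (sub_right_injective this))

theorem eval_ne_zero_of_notMem_pointPrimes {l : ℕ} {x : Fin l → F} {P : PrimePoly F}
    (h : P ∉ pointPrimes x) (i : Fin l) : P.1.eval (x i) ≠ 0 := by
  intro h0
  let Q : PrimePoly F := ⟨X - C (x i), monic_X_sub_C _, irreducible_X_sub_C _⟩
  have : Q = P := PrimePoly.eq_of_dvd (dvd_iff_isRoot.2 h0)
  exact h (mem_pointPrimes.2 ⟨i, congrArg (fun P : PrimePoly F => P.1) this⟩)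

theorem notMem_pointPrimes_of_dvd {l : ℕ} {x : Fin l → F} {P : PrimePoly F} {f : F[X]}
    (hd : P.1 ∣ f) (hf : ∀ i, f.eval (x i) ≠ 0) : P ∉ pointPrimes x := by
  intro h
  obtain ⟨i, hi⟩ := mem_pointPrimes.1 h
  rw [← hi, dvd_iff_isRoot] at hd
  exact hf i hd

end PointPrimes

/-! ### Zeta values and Euler products -/

section EulerProducts
variable {F : Type*} [Field F] [Fintype F]

theorem polyZeta_eq {s : ℝ} (hs : 1 < s) :
    polyZeta F s = (1 - (Fintype.card F : ℝ) ^ (1 - s))⁻¹ := by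
  have hq := one_lt_cardR (F := F)
  have hq0 := cardR_pos (F := F)
  let g : {f : F[X] // f.Monic} → ℕ := fun f => f.1.natDegree
  have key : ∀ n : ℕ, ∑' f : {f // g f = n}, polyNorm f.1.1 ^ (-s)
      = ((Fintype.card F : ℝ) ^ (1 - s)) ^ n := fun n => by
    have : ∀ f : {f // g f = n}, polyNorm f.1.1 ^ (-s) = ((Fintype.card F : ℝ) ^ n) ^ (-s) :=
      fun f => by rw [polyNorm, show f.1.1.natDegree = n from f.2]
    rw [tsum_congr this, tsum_const, card_monic_natDegree, nsmul_eq_mul]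
    push_cast
    rw [← Real.rpow_natCast, ← Real.rpow_natCast, ← Real.rpow_mul hq0.le,
      ← Real.rpow_add hq0, ← Real.rpow_mul hq0.le]
    ring_nf
  have hsum := (Equiv.sigmaFiberEquiv g).summable_iff.2 (summable_polyZeta F hs)
  simp only [Function.comp_def] at hsum
  rw [polyZeta, ← (Equiv.sigmaFiberEquiv g).tsum_eq, hsum.tsum_sigma]
  refine (tsum_congr key).trans ?_
  exact tsum_geometric_of_lt_one (Real.rpow_nonneg hq0.le _)
    (Real.rpow_lt_one_of_one_lt_of_neg hq (by linarith))

theorem polyZeta_two : polyZeta F 2 = (1 - 1 / (Fintype.card F : ℝ))⁻¹ := by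
  rw [polyZeta_eq (by norm_num), show (1 : ℝ) - 2 = -1 by norm_num, Real.rpow_neg_one, one_div]

theorem two_rpow_neg_lt_one {θ : ℝ} (h0 : 0 < θ) : (2 : ℝ) ^ (-θ) < 1 :=
  Real.rpow_lt_one_of_one_lt_of_neg (by norm_num) (by linarith)

theorem rpow_neg_le_two_rpow_neg {θ t : ℝ} (h0 : 0 < θ) (ht : 2 ≤ t) : t ^ (-θ) ≤ 2 ^ (-θ) :=
  Real.rpow_le_rpow_of_nonpos (by norm_num) ht (by linarith)

theorem sum_polyNorm_rpow_le {θ : ℝ} (h0 : 0 < θ) (S : Finset (PrimePoly F)) :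
    ∑ P ∈ S, polyNorm P.1 ^ (-(1 + θ)) ≤ (1 - 2 ^ (-θ))⁻¹ := by
  classical
  have h1 : ∑ P ∈ S, polyNorm P.1 ^ (-(1 + θ)) ≤ polyZeta F (1 + θ) := by
    rw [← Finset.sum_image (f := fun f : {f : F[X] // f.Monic} => polyNorm f.1 ^ (-(1 + θ)))
      (PrimePoly.toMonic_injective (F := F)).injOn]
    exact (summable_polyZeta F (by linarith)).sum_le_tsum _
      fun f _ => Real.rpow_nonneg (polyNorm_pos _).le _
  refine h1.trans ?_
  rw [polyZeta_eq (by linarith), show 1 - (1 + θ) = -θ by ring]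
  have := two_rpow_neg_lt_one h0
  have := rpow_neg_le_two_rpow_neg h0 (two_le_cardR (F := F))
  gcongr

theorem multipliable_one_sub_polyNorm_sq :
    Multipliable (fun P : PrimePoly F => (1 - 1 / polyNorm P.1 ^ 2 : ℝ)) := by
  simp only [sub_eq_add_neg]
  refine Real.multipliable_one_add_of_summable (Summable.neg ?_)
  refine ((summable_polyZeta F (s := 2) (by norm_num)).comp_injective
    PrimePoly.toMonic_injective).congr fun P => ?_
  simp only [Function.comp]
  rw [Real.rpow_neg (polyNorm_pos _).le, Real.rpow_two, one_div]

open Classical in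
variable (F) in
/-- The finite set of monic irreducible polynomials of degree at most `N`. -/
noncomputable def primesLE (N : ℕ) : Finset (PrimePoly F) :=
  ((Finset.range (N + 1)).biUnion fun k => monics F k).subtype _

theorem mem_primesLE {N : ℕ} {P : PrimePoly F} : P ∈ primesLE F N ↔ P.1.natDegree ≤ N := by
  simp [primesLE, P.2.1]

theorem polyNorm_of_mem_pointPrimes {l : ℕ} {x : Fin l → F} {P : PrimePoly F}
    (h : P ∈ pointPrimes x) : polyNorm P.1 = Fintype.card F := by
  obtain ⟨i, hi⟩ := mem_pointPrimes.1 h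
  rw [← hi, polyNorm, natDegree_X_sub_C, pow_one]

/-- Only primes dividing `f` matter; they have degree at most `deg f` and avoid the points. Thus `S`
may be enlarged freely. -/
theorem sieve_iff {l : ℕ} {x : Fin l → F} {f g : F[X]} (hf : f.Monic) (hfx : ∀ i, f.eval (x i) ≠ 0)
    {S : Finset (PrimePoly F)} (hS : primesLE F f.natDegree ⊆ S) :
    (∀ P ∈ S, P ∉ pointPrimes x → ¬ sieveModulus g P ∣ f) ↔ Squarefree f ∧ IsCoprime f g := by
  have hle : ∀ P : PrimePoly F, P.1 ∣ f → P ∈ S := fun P hd =>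
    hS (mem_primesLE.2 (natDegree_le_of_dvd hd hf.ne_zero))
  constructor
  · intro h
    constructor
    · intro y hy
      by_contra hu
      obtain ⟨P, hP1, hP2, hPd⟩ := exists_monic_irreducible_factor y hu
      have hPP : P * P ∣ f := (mul_dvd_mul hPd hPd).trans hy
      have hPf : P ∣ f := (Dvd.intro _ rfl).trans hPP
      refine h ⟨P, hP1, hP2⟩ (hle ⟨P, hP1, hP2⟩ hPf) (notMem_pointPrimes_of_dvd hPf hfx) ?_
      unfold sieveModulus
      split_ifs
      · exact hPf
      · rwa [sq]
    · refine isCoprime_of_irreducible_dvd (fun h => hf.ne_zero h.1) fun z hz hzf hzg => ?_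
      obtain ⟨P, hP1, hP2, hPd⟩ := exists_monic_irreducible_factor z hz.not_isUnit
      have hPf := hPd.trans hzf
      refine h ⟨P, hP1, hP2⟩ (hle ⟨P, hP1, hP2⟩ hPf) (notMem_pointPrimes_of_dvd hPf hfx) ?_
      rwa [sieveModulus, if_pos (hPd.trans hzg)]
  · rintro ⟨h1, h2⟩ P - - hd
    unfold sieveModulus at hd
    split_ifs at hd with hPg
    · exact P.2.2.not_isUnit (h2.isUnit_of_dvd' hd hPg)
    · rw [sq] at hd
      exact P.2.2.not_isUnit (h1 _ hd)

open Classical in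
theorem abs_card_sqfree_coprime_sub_le {l : ℕ} {x : Fin l → F} (hx : Function.Injective x)
    {c : Fin l → F} (hc : ∀ i, c i ≠ 0) {g : F[X]} (hg : g.Monic) (n : ℕ)
    {S : Finset (PrimePoly F)} (hS : primesLE F n ⊆ S) :
    |(({f ∈ valuedMonics x c n | Squarefree f ∧ IsCoprime f g} : Finset F[X]).card : ℝ)
        - (Fintype.card F : ℝ) ^ ((n : ℤ) - l) *
          ∏ P ∈ S with P ∉ pointPrimes x, (1 - 1 / polyNorm (sieveModulus g P))|
      ≤ ∑ k ∈ Finset.range (g.natDegree + 1), ∑ _e ∈ monics F k with _e ∣ g,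
          6 * (Fintype.card F : ℝ) ^ ((((n : ℤ) - k : ℤ) : ℝ) / 2) := by
  have h1 := abs_card_sieve_sub_le hx (sieveModulus g) {P ∈ S | P ∉ pointPrimes x}
    (fun P _ => monic_sieveModulus g P) (fun P _ Q _ h => isCoprime_sieveModulus g h) ?_ c n
  · refine le_trans (le_of_eq ?_) (h1.trans (sum_powerset_min_le hg _ n))
    congr 4
    ext f
    simp only [Finset.mem_filter, valuedMonics, mem_monics, and_imp]
    refine and_congr_right fun ⟨⟨hf1, hf2⟩, hf3⟩ => ?_
    refine (sieve_iff hf1 (fun i => by rw [hf3]; exact hc i) ?_).symm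
    rwa [show f.natDegree = n by exact_mod_cast hf2]
  · intro P hP i
    have := eval_ne_zero_of_notMem_pointPrimes (Finset.mem_filter.1 hP).2 i
    unfold sieveModulus
    split_ifs
    · exact this
    · rw [eval_pow]; exact pow_ne_zero _ this

/-- The sieve with no points and `g = 1` is compared with the exact square-free count. As `n` grows
this evaluates the Euler product of `1/ζ(2)`. -/
theorem abs_one_sub_prod_le (n : ℕ) (hn : 2 ≤ n) {S : Finset (PrimePoly F)} (hS : primesLE F n ⊆ S) :
    |(1 - 1 / (Fintype.card F : ℝ)) - ∏ P ∈ S, (1 - 1 / polyNorm P.1 ^ 2)|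
      ≤ 24 * ((Fintype.card F : ℝ) ^ (-(1 / 2 : ℝ))) ^ n := by
  classical
  have hq0 := cardR_pos (F := F)
  have h := abs_card_sqfree_coprime_sub_le (x := (Fin.elim0 : Fin 0 → F)) (fun i => i.elim0)
    (c := Fin.elim0) (fun i => i.elim0) (monic_one (R := F)) n hS
  have h2 := sum_sum_divisors_le (F := F) 0 n
  rw [show monics F (0 : ℕ) = {1} by
    ext f; simp only [mem_monics, Finset.mem_singleton]
    constructor
    · rintro ⟨h1, h2⟩; exact h1.natDegree_eq_zero.1 (by exact_mod_cast h2)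
    · rintro rfl; simp, Finset.sum_singleton] at h2
  rw [natDegree_one] at h
  have h3 := h.trans h2
  have e1 : ({f ∈ valuedMonics (Fin.elim0 : Fin 0 → F) Fin.elim0 n | Squarefree f ∧ IsCoprime f 1} :
      Finset F[X]) = sqfreeMonics F n := by
    ext f
    simp [valuedMonics, mem_sqfreeMonics, isCoprime_one_right]
  have e2 : ∏ P ∈ S with P ∉ pointPrimes (Fin.elim0 : Fin 0 → F), (1 - 1 / polyNorm (sieveModulus 1 P))
      = ∏ P ∈ S, (1 - 1 / polyNorm P.1 ^ 2) := by
    refine Finset.prod_congr (Finset.filter_true_of_mem fun P _ hP => ?_) fun P _ => ?_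
    · obtain ⟨i, -⟩ := mem_pointPrimes.1 hP
      exact i.elim0
    · rw [sieveModulus, if_neg fun h => P.2.2.not_isUnit (isUnit_of_dvd_one h), polyNorm, polyNorm,
        P.2.1.natDegree_pow, mul_comm, pow_mul]
  rw [e1, e2, card_sqfreeMonics (by exact_mod_cast hn), Nat.cast_zero, sub_zero, ← mul_sub, abs_mul,
    abs_of_pos (by positivity)] at h3
  have hqn : (0 : ℝ) < (Fintype.card F : ℝ) ^ (n : ℤ) := by positivity
  refine le_of_mul_le_mul_left (h3.trans (le_of_eq ?_)) hqn
  rw [zpow_natCast, ← Real.rpow_natCast, ← Real.rpow_natCast, ← Real.rpow_mul hq0.le, mul_left_comm,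
    ← Real.rpow_add hq0]
  congr 2; push_cast; ring

open Filter Topology in
theorem hasProd_one_sub_polyNorm_sq :
    HasProd (fun P : PrimePoly F => (1 - 1 / polyNorm P.1 ^ 2 : ℝ)) (1 - 1 / Fintype.card F) := by
  have hq := one_lt_cardR (F := F)
  have hq0 := cardR_pos (F := F)
  have hm := (multipliable_one_sub_polyNorm_sq (F := F)).hasProd
  set L := ∏' P : PrimePoly F, (1 - 1 / polyNorm P.1 ^ 2 : ℝ)
  have hT : Tendsto (fun S : Finset (PrimePoly F) => ∏ P ∈ S, (1 - 1 / polyNorm P.1 ^ 2 : ℝ))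
    atTop (𝓝 L) := hm
  have hle : ∀ n : ℕ, 2 ≤ n → |(1 - 1 / (Fintype.card F : ℝ)) - L|
      ≤ 24 * ((Fintype.card F : ℝ) ^ (-(1 / 2 : ℝ))) ^ n := fun n hn => by
    refine le_of_tendsto ((tendsto_const_nhds.sub hT).abs) ?_
    filter_upwards [eventually_ge_atTop (primesLE F n)] with S hS
    exact abs_one_sub_prod_le n hn hS
  have hlim : Tendsto (fun n : ℕ => 24 * ((Fintype.card F : ℝ) ^ (-(1 / 2 : ℝ))) ^ n) atTop (𝓝 0) := by
    have := (tendsto_pow_atTop_nhds_zero_of_lt_one (r := (Fintype.card F : ℝ) ^ (-(1 / 2 : ℝ)))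
      (by positivity) (Real.rpow_lt_one_of_one_lt_of_neg hq (by norm_num))).const_mul 24
    simpa using this
  have h0 : |(1 - 1 / (Fintype.card F : ℝ)) - L| ≤ 0 :=
    ge_of_tendsto hlim (by filter_upwards [eventually_ge_atTop 2] with n hn using hle n hn)
  rw [abs_nonpos_iff, sub_eq_zero] at h0
  rw [h0]; exact hm

open Filter Topology in
-- Factor by factor, `K` dominates `∏ (1 - 1/|P|²) = 1 - 1/q`.
theorem half_le_eulerK : 1 / 2 ≤ eulerK F := by
  have h1 : Tendsto (fun S : Finset (PrimePoly F) => ∏ P ∈ S, (1 - 1 / (polyNorm P.1 + 1) ^ 2 : ℝ))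
    atTop (𝓝 (eulerK F)) := (multipliable_eulerK F).hasProd
  have h2 : Tendsto (fun S : Finset (PrimePoly F) => ∏ P ∈ S, (1 - 1 / polyNorm P.1 ^ 2 : ℝ))
    atTop (𝓝 (1 - 1 / Fintype.card F)) := hasProd_one_sub_polyNorm_sq
  have h3 : 1 - 1 / (Fintype.card F : ℝ) ≤ eulerK F := by
    refine le_of_tendsto_of_tendsto' h2 h1 fun S => Finset.prod_le_prod ?_ ?_
    · intro P _
      have := two_le_polyNorm P
      rw [sub_nonneg, div_le_one (by positivity)]; nlinarith
    · intro P _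
      have := polyNorm_pos P.1
      gcongr
      linarith
  have : 1 / (Fintype.card F : ℝ) ≤ 1 / 2 := by have := two_le_cardR (F := F); gcongr
  linarith

end EulerProducts

/-! ### Assembling the count -/

section Assembly
variable {F : Type*} [Field F] [Fintype F]

open Classical in
/-- The local densities attached to the second factor: `0` at the points, and
`|P| / (|P| + 1)` elsewhere. -/
noncomputable def pointWeight {l : ℕ} (x : Fin l → F) (P : PrimePoly F) : ℝ :=
  if P ∈ pointPrimes x then 0 else polyNorm P.1 / (polyNorm P.1 + 1)

theorem pointWeight_nonneg {l : ℕ} (x : Fin l → F) (P : PrimePoly F) : 0 ≤ pointWeight x P := by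
  have := polyNorm_pos P.1
  unfold pointWeight; split_ifs <;> positivity

theorem pointWeight_le_one {l : ℕ} (x : Fin l → F) (P : PrimePoly F) : pointWeight x P ≤ 1 := by
  have := polyNorm_pos P.1
  unfold pointWeight; split_ifs
  · norm_num
  · rw [div_le_one (by positivity)]; linarith

/-- A point contributes exactly `1 / (1 - q^(-θ))`. Elsewhere `1 - pointWeight = 1/(|P|+1)`, so the
factors are `1 + O(|P|^(-1-θ))` and their product converges uniformly in `q`. -/
theorem prod_errorFactor_le {l : ℕ} {x : Fin l → F} (hx : Function.Injective x) {θ : ℝ} (h0 : 0 < θ)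
    (S : Finset (PrimePoly F)) :
    ∏ P ∈ S, errorFactor (pointWeight x) θ P
      ≤ ((1 - (Fintype.card F : ℝ) ^ (-θ))⁻¹) ^ l * Real.exp ((1 - 2 ^ (-θ))⁻¹ ^ 2) := by
  classical
  have hef : ∀ P, 1 ≤ errorFactor (pointWeight x) θ P :=
    one_le_errorFactor (pointWeight_le_one x) h0
  have h2 := two_rpow_neg_lt_one h0
  rw [← Finset.prod_filter_mul_prod_filter_not S (· ∈ pointPrimes x)]
  refine mul_le_mul ?_ ?_ (Finset.prod_nonneg fun P _ => by linarith [hef P]) ?_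
  · have e : ∀ P ∈ pointPrimes x, errorFactor (pointWeight x) θ P
        = (1 - (Fintype.card F : ℝ) ^ (-θ))⁻¹ := by
      intro P hP
      have := polyNorm_rpow_neg_lt_one h0 P
      rw [errorFactor, pointWeight, if_pos hP, ← polyNorm_of_mem_pointPrimes hP]
      have : 1 - polyNorm P.1 ^ (-θ) ≠ 0 := by linarith
      field_simp
      ring
    calc ∏ P ∈ S with P ∈ pointPrimes x, errorFactor (pointWeight x) θ P
        ≤ ∏ P ∈ pointPrimes x, errorFactor (pointWeight x) θ P :=
          Finset.prod_le_prod_of_subset_of_one_le (fun P hP => (Finset.mem_filter.1 hP).2)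
            (fun P _ => by linarith [hef P]) fun P _ _ => hef P
      _ = _ := by rw [Finset.prod_congr rfl e, Finset.prod_const, card_pointPrimes hx]
  · calc ∏ P ∈ S with P ∉ pointPrimes x, errorFactor (pointWeight x) θ P
        ≤ ∏ P ∈ S with P ∉ pointPrimes x,
          Real.exp (polyNorm P.1 ^ (-(1 + θ)) * (1 - 2 ^ (-θ))⁻¹) := by
          refine Finset.prod_le_prod (fun P _ => by linarith [hef P]) fun P hP => ?_
          refine le_trans ?_ (Real.add_one_le_exp _)
          have hp := polyNorm_pos P.1
          have hy := polyNorm_rpow_neg_lt_one h0 P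
          have hy2 := rpow_neg_le_two_rpow_neg h0 (two_le_polyNorm P)
          rw [errorFactor, pointWeight, if_neg (Finset.mem_filter.1 hP).2, add_comm,
            show -(1 + θ) = -1 + -θ by ring, Real.rpow_add hp, Real.rpow_neg_one, mul_assoc,
            ← div_eq_mul_inv]
          have : 1 - polyNorm P.1 / (polyNorm P.1 + 1) = (polyNorm P.1 + 1)⁻¹ := by field_simp; ring
          rw [this]
          gcongr
          linarith
      _ = Real.exp ((∑ P ∈ S with P ∉ pointPrimes x, polyNorm P.1 ^ (-(1 + θ))) * (1 - 2 ^ (-θ))⁻¹) := by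
          rw [← Real.exp_sum, Finset.sum_mul]
      _ ≤ _ := by
          rw [sq]
          have : 0 ≤ (1 - (2 : ℝ) ^ (-θ))⁻¹ := inv_nonneg.2 (by linarith)
          gcongr
          exact sum_polyNorm_rpow_le h0 _
  · have := rpow_neg_le_two_rpow_neg h0 (two_le_cardR (F := F))
    exact pow_nonneg (inv_nonneg.2 (by linarith)) _

open Classical in
theorem ncard_cubeFreeSet_eq {l : ℕ} (x : Fin l → F) {a : Fin l → F} (ha : ∀ i, a i ≠ 0) (d₁ d₂ : ℕ) :
    Set.ncard {f ∈ cubeFreeSet F d₁ d₂ | ∀ i, f.eval (x i) = a i}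
      = ∑ g ∈ sqfreeMonics F d₂ with ∀ i, g.eval (x i) ≠ 0,
        ({f ∈ valuedMonics x (fun i => a i / g.eval (x i) ^ 2) d₁ | Squarefree f ∧ IsCoprime f g} :
          Finset F[X]).card := by
  rw [← Finset.card_sigma, ← Set.ncard_coe_finset]
  symm
  refine Set.ncard_congr (fun p _ => p.2 * p.1 ^ 2) ?_ ?_ ?_
  · rintro ⟨g, f⟩ h
    simp only [Finset.coe_sigma, Set.mem_sigma_iff, Finset.mem_coe, Finset.mem_filter,
      mem_sqfreeMonics, valuedMonics, mem_monics] at h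
    obtain ⟨⟨⟨⟨g1, g2⟩, g3⟩, g4⟩, ⟨⟨f1, f2⟩, f3⟩, f4, f5⟩ := h
    refine ⟨⟨f, g, f1, g1, f4, g3, f5, by exact_mod_cast f2, by exact_mod_cast g2, rfl⟩, fun i => ?_⟩
    rw [eval_mul, eval_pow, f3]
    exact div_mul_cancel₀ _ (pow_ne_zero 2 (g4 i))
  · rintro ⟨g, f⟩ ⟨g', f'⟩ h h' he
    simp only [Finset.coe_sigma, Set.mem_sigma_iff, Finset.mem_coe, Finset.mem_filter,
      mem_sqfreeMonics, valuedMonics, mem_monics] at h h' he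
    obtain ⟨rfl, rfl⟩ := sq_mul_squarefree_unique h.1.1.1.1 h'.1.1.1.1 h.2.2.1 h'.2.2.1
      (by rw [mul_comm, he, mul_comm])
    rfl
  · rintro F' ⟨⟨f, g, f1, g1, f4, g3, f5, f2, g2, rfl⟩, h⟩
    have g4 : ∀ i, g.eval (x i) ≠ 0 := fun i h0 => ha i (by rw [← h i]; simp [h0])
    refine ⟨⟨g, f⟩, ?_, rfl⟩
    simp only [Finset.coe_sigma, Set.mem_sigma_iff, Finset.mem_coe, Finset.mem_filter,
      mem_sqfreeMonics, valuedMonics, mem_monics]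
    refine ⟨⟨⟨⟨g1, by exact_mod_cast g2⟩, g3⟩, g4⟩, ⟨⟨f1, by exact_mod_cast f2⟩, fun i => ?_⟩, f4, f5⟩
    rw [eq_div_iff (pow_ne_zero 2 (g4 i)), ← h i, eval_mul, eval_pow]

open Classical in
-- For `P ∣ g` the density changes by `(1 - 1/|P|) / (1 - 1/|P|²) = |P|/(|P|+1)`, which is the
-- source of `pointWeight`.
theorem prod_sieveModulus_eq {l : ℕ} {x : Fin l → F} {g : F[X]} (hg : ∀ i, g.eval (x i) ≠ 0)
    (S : Finset (PrimePoly F)) :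
    ∏ P ∈ S with P ∉ pointPrimes x, (1 - 1 / polyNorm (sieveModulus g P))
      = (∏ P ∈ S with P ∉ pointPrimes x, (1 - 1 / polyNorm P.1 ^ 2))
        * ∏ P ∈ S, primeWeight (pointWeight x) g P := by
  rw [Finset.prod_filter, Finset.prod_filter, ← Finset.prod_mul_distrib]
  refine Finset.prod_congr rfl fun P _ => ?_
  have hp := polyNorm_pos P.1
  by_cases hP : P ∈ pointPrimes x
  · have : ¬ P.1 ∣ g := fun h => notMem_pointPrimes_of_dvd h hg hP
    simp [hP, primeWeight, this]
  · by_cases hd : P.1 ∣ g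
    · simp only [hP, primeWeight, hd, sieveModulus, pointWeight, if_true, if_false, not_false_eq_true]
      field_simp
      ring
    · simp only [hP, primeWeight, hd, sieveModulus, if_true, if_false, not_false_eq_true, mul_one]
      rw [polyNorm, polyNorm, P.2.1.natDegree_pow, mul_comm, pow_mul]

open Classical in
theorem abs_ncard_sub_weightedSum_le {l : ℕ} {x : Fin l → F} (hx : Function.Injective x)
    {a : Fin l → F} (ha : ∀ i, a i ≠ 0) (d₁ d₂ : ℕ)
    {S : Finset (PrimePoly F)} (hS : primesLE F d₁ ⊆ S) (hxS : pointPrimes x ⊆ S) :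
    |(Set.ncard {f ∈ cubeFreeSet F d₁ d₂ | ∀ i, f.eval (x i) = a i} : ℝ)
      - (Fintype.card F : ℝ) ^ ((d₁ : ℤ) - l) *
        ((∏ P ∈ S with P ∉ pointPrimes x, (1 - 1 / polyNorm P.1 ^ 2))
          * weightedSum (pointWeight x) S d₂)|
      ≤ 24 * (Fintype.card F : ℝ) ^ (d₂ + (d₁ : ℝ) / 2) := by
  have hW : weightedSum (pointWeight x) S d₂ = ∑ g ∈ sqfreeMonics F d₂ with ∀ i, g.eval (x i) ≠ 0,
      ∏ P ∈ S, primeWeight (pointWeight x) g P := by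
    rw [weightedSum, Finset.sum_filter]
    refine Finset.sum_congr rfl fun g _ => ?_
    split_ifs with h
    · rfl
    · push Not at h
      obtain ⟨i, hi⟩ := h
      have hP : (⟨X - C (x i), monic_X_sub_C _, irreducible_X_sub_C _⟩ : PrimePoly F) ∈ pointPrimes x :=
        mem_pointPrimes.2 ⟨i, rfl⟩
      refine Finset.prod_eq_zero (hxS hP) ?_
      rw [primeWeight, if_pos (dvd_iff_isRoot.2 hi), pointWeight, if_pos hP]
  rw [ncard_cubeFreeSet_eq x ha, hW, Finset.mul_sum, Finset.mul_sum]
  push_cast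
  rw [← Finset.sum_sub_distrib]
  calc _ ≤ ∑ g ∈ sqfreeMonics F d₂ with ∀ i, g.eval (x i) ≠ 0,
        ∑ k ∈ Finset.range (d₂ + 1), ∑ _e ∈ monics F k with _e ∣ g,
          6 * (Fintype.card F : ℝ) ^ ((((d₁ : ℤ) - k : ℤ) : ℝ) / 2) := by
        refine (Finset.abs_sum_le_sum_abs _ _).trans (Finset.sum_le_sum fun g hg => ?_)
        obtain ⟨hg1, hg2⟩ := Finset.mem_filter.1 hg
        obtain ⟨⟨hg3, hg4⟩, -⟩ := mem_sqfreeMonics.1 hg1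
        have := abs_card_sqfree_coprime_sub_le hx (c := fun i => a i / g.eval (x i) ^ 2)
          (fun i => div_ne_zero (ha i) (pow_ne_zero 2 (hg2 i))) hg3 d₁ hS
        rwa [prod_sieveModulus_eq hg2, show g.natDegree = d₂ by exact_mod_cast hg4] at this
    _ ≤ ∑ g ∈ monics F d₂, ∑ k ∈ Finset.range (d₂ + 1), ∑ _e ∈ monics F k with _e ∣ g,
          6 * (Fintype.card F : ℝ) ^ ((((d₁ : ℤ) - k : ℤ) : ℝ) / 2) := by
        refine Finset.sum_le_sum_of_subset_of_nonneg ((Finset.filter_subset _ _).trans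
          (Finset.filter_subset _ _)) fun g _ _ => ?_
        exact Finset.sum_nonneg fun k _ => Finset.sum_nonneg fun e _ => by positivity
    _ ≤ _ := by
        have := sum_sum_divisors_le (F := F) d₂ d₁
        rwa [Int.cast_natCast] at this

open Classical Filter Topology in
-- Off the points the local factor is `(1 - 1/|P|²)(1 - 1/(|P|+1)²)`. At a point it is `q/(q+1)`,
-- and `ρ` is the ratio of this to the generic factor with `|P| = q`.
theorem tendsto_localDensities {l : ℕ} {x : Fin l → F} (hx : Function.Injective x) :
    Tendsto (fun S : Finset (PrimePoly F) =>
      (∏ P ∈ S with P ∉ pointPrimes x, (1 - 1 / polyNorm P.1 ^ 2)) *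
        ∏ P ∈ S, (1 - (1 - pointWeight x P) / (polyNorm P.1 + 1))) atTop
      (𝓝 ((1 - 1 / Fintype.card F) * eulerK F * ((Fintype.card F : ℝ) ^ 2 /
        ((Fintype.card F - 1) * (Fintype.card F + 2))) ^ l)) := by
  have hq := one_lt_cardR (F := F)
  set ρ := (Fintype.card F : ℝ) ^ 2 / ((Fintype.card F - 1) * (Fintype.card F + 2)) with hρ
  have hr : HasProd (fun P : PrimePoly F => if P ∈ pointPrimes x then ρ else 1) (ρ ^ l) := by
    have := hasProd_prod_of_ne_finset_one (f := fun P : PrimePoly F => if P ∈ pointPrimes x then ρ else 1)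
      (s := pointPrimes x) (L := SummationFilter.unconditional _) fun P hP => if_neg hP
    rwa [Finset.prod_congr rfl fun P hP => if_pos hP, Finset.prod_const, card_pointPrimes hx] at this
  have := (hasProd_one_sub_polyNorm_sq.mul (multipliable_eulerK F).hasProd).mul hr
  refine Tendsto.congr (fun S => ?_) this
  rw [Finset.prod_filter, ← Finset.prod_mul_distrib]
  refine Finset.prod_congr rfl fun P _ => ?_
  have hp := two_le_polyNorm P
  by_cases hP : P ∈ pointPrimes x
  · have hn := polyNorm_of_mem_pointPrimes hP
    simp only [hP, if_true, not_true_eq_false, if_false, pointWeight, hρ, hn]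
    have : (Fintype.card F : ℝ) - 1 ≠ 0 := by linarith
    have : (Fintype.card F : ℝ) ≠ 0 := by linarith
    have : (Fintype.card F : ℝ) + 1 ≠ 0 := by linarith
    have : (Fintype.card F : ℝ) + 2 ≠ 0 := by linarith
    field_simp
    ring
  · simp only [hP, if_true, not_false_eq_true, if_false, pointWeight, mul_one]
    congr 1
    field_simp
    ring

open Filter Topology in
theorem abs_ncard_sub_main_le {l : ℕ} {x : Fin l → F} (hx : Function.Injective x)
    {a : Fin l → F} (ha : ∀ i, a i ≠ 0) (d₁ d₂ : ℕ) {θ : ℝ} (h0 : 0 < θ) (h1 : θ ≤ 1) :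
    |(Set.ncard {f ∈ cubeFreeSet F d₁ d₂ | ∀ i, f.eval (x i) = a i} : ℝ)
      - (Fintype.card F : ℝ) ^ ((d₁ : ℤ) - l + d₂) * ((1 - 1 / Fintype.card F) *
        ((1 - 1 / Fintype.card F) * eulerK F * ((Fintype.card F : ℝ) ^ 2 /
        ((Fintype.card F - 1) * (Fintype.card F + 2))) ^ l))|
      ≤ 24 * (Fintype.card F : ℝ) ^ (d₂ + (d₁ : ℝ) / 2)
        + (Fintype.card F : ℝ) ^ ((d₁ : ℤ) - l) * ((Fintype.card F : ℝ) ^ (θ * d₂)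
          * (((1 - (Fintype.card F : ℝ) ^ (-θ))⁻¹) ^ l * Real.exp ((1 - 2 ^ (-θ))⁻¹ ^ 2))) := by
  classical
  have hq0 := cardR_pos (F := F)
  refine le_of_tendsto ((tendsto_const_nhds.sub
    (((tendsto_localDensities hx).const_mul _).const_mul _)).abs) ?_
  filter_upwards [eventually_ge_atTop (primesLE F d₁ ∪ pointPrimes x)] with S hS
  have e1 := abs_ncard_sub_weightedSum_le hx ha d₁ d₂ (Finset.union_subset_left hS)
    (Finset.union_subset_right hS)
  have e2 := abs_weightedSum_sub_le (pointWeight_nonneg x) (pointWeight_le_one x) h0 h1 S d₂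
  have e3 := e2.trans (mul_le_mul_of_nonneg_left (prod_errorFactor_le hx h0 S) (by positivity))
  have hf : ∀ P : PrimePoly F, 0 ≤ 1 - 1 / polyNorm P.1 ^ 2 ∧ 1 - 1 / polyNorm P.1 ^ 2 ≤ 1 := by
    intro P
    have := two_le_polyNorm P
    refine ⟨?_, by linarith [show 0 ≤ 1 / polyNorm P.1 ^ 2 by positivity]⟩
    rw [sub_nonneg, div_le_one (by positivity)]; nlinarith
  set Z := ∏ P ∈ S with P ∉ pointPrimes x, (1 - 1 / polyNorm P.1 ^ 2)
  have hZ0 : 0 ≤ Z := Finset.prod_nonneg fun P _ => (hf P).1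
  have hZ1 : Z ≤ 1 := Finset.prod_le_one (fun P _ => (hf P).1) fun P _ => (hf P).2
  have hqd : (0 : ℝ) < (Fintype.card F : ℝ) ^ ((d₁ : ℤ) - l) := by positivity
  rw [Int.cast_natCast] at e3
  have e4 : |(Fintype.card F : ℝ) ^ ((d₁ : ℤ) - l) * Z * (weightedSum (pointWeight x) S d₂ -
      (Fintype.card F : ℝ) ^ (d₂ : ℤ) * ((1 - 1 / Fintype.card F) *
        ∏ P ∈ S, (1 - (1 - pointWeight x P) / (polyNorm P.1 + 1))))|
      ≤ (Fintype.card F : ℝ) ^ ((d₁ : ℤ) - l) * ((Fintype.card F : ℝ) ^ (θ * d₂)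
          * (((1 - (Fintype.card F : ℝ) ^ (-θ))⁻¹) ^ l * Real.exp ((1 - 2 ^ (-θ))⁻¹ ^ 2))) := by
    rw [abs_mul, abs_of_nonneg (mul_nonneg hqd.le hZ0)]
    exact mul_le_mul (mul_le_of_le_one_right hqd.le hZ1) e3 (abs_nonneg _) hqd.le
  refine le_trans (le_of_eq ?_) ((abs_add_le _ _).trans (add_le_add e1 e4))
  congr 1
  rw [zpow_add₀ hq0.ne']
  ring

/-- If `q^ε ≥ 2`, each factor is at most `q^ε`. Otherwise `l ≤ q < 2^(1/ε)`, so the whole power is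
bounded in terms of `ε`. -/
theorem inv_pow_le_rpow {ε : ℝ} (h0 : 0 < ε) {q : ℝ} (hq : 2 ≤ q) {l : ℕ} (hl : (l : ℝ) ≤ q) :
    ((1 - q ^ (-ε))⁻¹) ^ l ≤ ((1 - 2 ^ (-ε))⁻¹) ^ ((2 : ℝ) ^ (1 / ε)) * q ^ (ε * l) := by
  have hq0 : 0 < q := by linarith
  have h2 := two_rpow_neg_lt_one h0
  have h2' : (0 : ℝ) < 2 ^ (-ε) := by positivity
  have hle := rpow_neg_le_two_rpow_neg h0 hq
  have hb : 1 ≤ (1 - (2 : ℝ) ^ (-ε))⁻¹ := (one_le_inv₀ (by linarith)).2 (by linarith)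
  have hG : 1 ≤ ((1 - (2 : ℝ) ^ (-ε))⁻¹) ^ ((2 : ℝ) ^ (1 / ε)) := Real.one_le_rpow hb (by positivity)
  have hq1 : 1 ≤ q ^ (ε * l) := Real.one_le_rpow (by linarith) (by positivity)
  rcases le_or_gt 2 (q ^ ε) with h | h
  · have h3 : (1 - q ^ (-ε))⁻¹ ≤ q ^ ε := by
      have hpos : 0 < 1 - q ^ (-ε) := by linarith
      rw [inv_le_iff_one_le_mul₀ hpos, mul_sub, ← Real.rpow_add hq0]
      simp only [add_neg_cancel, Real.rpow_zero]
      linarith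
    calc ((1 - q ^ (-ε))⁻¹) ^ l ≤ (q ^ ε) ^ l :=
          pow_le_pow_left₀ (inv_nonneg.2 (by linarith)) h3 _
      _ = q ^ (ε * l) := by rw [← Real.rpow_natCast, ← Real.rpow_mul hq0.le]
      _ ≤ _ := le_mul_of_one_le_left (by linarith) hG
  · have hql : q ≤ 2 ^ (1 / ε) := by
      calc q = (q ^ ε) ^ (1 / ε) := by
            rw [← Real.rpow_mul hq0.le, mul_one_div_cancel h0.ne', Real.rpow_one]
        _ ≤ _ := Real.rpow_le_rpow (by positivity) h.le (by positivity)
    calc ((1 - q ^ (-ε))⁻¹) ^ l ≤ ((1 - (2 : ℝ) ^ (-ε))⁻¹) ^ l := by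
          refine pow_le_pow_left₀ (inv_nonneg.2 (by linarith)) ?_ _
          exact inv_anti₀ (by linarith) (by linarith)
      _ = ((1 - (2 : ℝ) ^ (-ε))⁻¹) ^ (l : ℝ) := (Real.rpow_natCast _ _).symm
      _ ≤ ((1 - (2 : ℝ) ^ (-ε))⁻¹) ^ ((2 : ℝ) ^ (1 / ε)) :=
          Real.rpow_le_rpow_of_exponent_le hb (hl.trans hql)
      _ ≤ _ := le_mul_of_one_le_right (by linarith) hq1

/-- The inverse of the base is `1 + 1/q - 2/q² ≤ exp (1/q)`, and `l ≤ q`. -/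
theorem exp_neg_one_le_pow {q : ℝ} (hq : 2 ≤ q) {l : ℕ} (hl : (l : ℝ) ≤ q) :
    Real.exp (-1) ≤ (q ^ 2 / ((q - 1) * (q + 2))) ^ l := by
  have hq0 : 0 < q := by linarith
  have h1 : Real.exp (-(1 / q)) ≤ q ^ 2 / ((q - 1) * (q + 2)) := by
    rw [Real.exp_neg, inv_le_comm₀ (Real.exp_pos _)
      (div_pos (by positivity) (mul_pos (by linarith) (by linarith)))]
    refine le_trans ?_ (Real.add_one_le_exp _)
    rw [inv_div, div_le_iff₀ (by positivity)]
    field_simp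
    nlinarith
  refine le_trans ?_ (pow_le_pow_left₀ (Real.exp_pos _).le h1 l)
  rw [← Real.exp_nat_mul, Real.exp_le_exp, mul_neg, neg_le_neg_iff, mul_one_div, div_le_one hq0]
  exact hl

/-- The implied constant. -/
noncomputable def errorConstant (ε : ℝ) : ℝ :=
  8 * Real.exp 1 * (24 + Real.exp ((1 - 2 ^ (-ε))⁻¹ ^ 2) * ((1 - 2 ^ (-ε))⁻¹) ^ ((2 : ℝ) ^ (1 / ε)))

theorem exists_relative_error {l : ℕ} {x : Fin l → F} (hx : Function.Injective x)
    {a : Fin l → F} (ha : ∀ i, a i ≠ 0) (d₁ d₂ : ℕ) {ε : ℝ} (h0 : 0 < ε) (h1 : ε ≤ 1) :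
    ∃ E : ℝ,
      |E| ≤ errorConstant ε * ((Fintype.card F : ℝ) ^ (-(1 - ε) * d₂ + ε * l)
        + (Fintype.card F : ℝ) ^ (-(d₁ : ℝ) / 2 + l)) ∧
      (Set.ncard {f ∈ cubeFreeSet F d₁ d₂ | ∀ i, f.eval (x i) = a i} : ℝ) =
        eulerK F * (Fintype.card F : ℝ) ^ (d₁ + d₂) / polyZeta F 2 ^ 2
          * ((Fintype.card F : ℝ)
            / (((Fintype.card F : ℝ) + 2) * ((Fintype.card F : ℝ) - 1))) ^ l
          * (1 + E) := by
  have hq := two_le_cardR (F := F)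
  have hq0 := cardR_pos (F := F)
  have hl : (l : ℝ) ≤ Fintype.card F := by
    exact_mod_cast (by simpa using Fintype.card_le_of_injective x hx : l ≤ Fintype.card F)
  have key := abs_ncard_sub_main_le hx ha d₁ d₂ h0 h1
  set N : ℝ := (Set.ncard {f ∈ cubeFreeSet F d₁ d₂ | ∀ i, f.eval (x i) = a i} : ℝ)
  have hmain : eulerK F * (Fintype.card F : ℝ) ^ (d₁ + d₂) / polyZeta F 2 ^ 2
          * ((Fintype.card F : ℝ)
            / (((Fintype.card F : ℝ) + 2) * ((Fintype.card F : ℝ) - 1))) ^ l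
      = (Fintype.card F : ℝ) ^ ((d₁ : ℤ) - l + d₂) * ((1 - 1 / Fintype.card F) *
        ((1 - 1 / Fintype.card F) * eulerK F * ((Fintype.card F : ℝ) ^ 2 /
        ((Fintype.card F - 1) * (Fintype.card F + 2))) ^ l)) := by
    have e : (Fintype.card F : ℝ) ^ 2 / ((Fintype.card F - 1) * (Fintype.card F + 2))
        = Fintype.card F * (Fintype.card F / ((Fintype.card F + 2) * (Fintype.card F - 1))) := by
      rw [mul_comm ((Fintype.card F : ℝ) - 1)]; ring
    rw [polyZeta_two, e, mul_pow, zpow_add₀ hq0.ne', zpow_sub₀ hq0.ne', zpow_natCast, zpow_natCast,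
      zpow_natCast, inv_pow, div_inv_eq_mul, pow_add]
    field_simp
  rw [hmain]
  set q := (Fintype.card F : ℝ)
  set D := q ^ ((d₁ : ℤ) - l + d₂) with hD
  set κ := (1 - 1 / q) * ((1 - 1 / q) * eulerK F * (q ^ 2 / ((q - 1) * (q + 2))) ^ l)
  have hD0 : 0 < D := by positivity
  -- Two factors `1 - 1/q` and `K` are each at least `1/2`, and the point factors contribute at
  -- least `1/e`.
  have hκ : (8 * Real.exp 1)⁻¹ ≤ κ := by
    have t1 : 1 / 2 ≤ 1 - 1 / q := by
      have : 1 / q ≤ 1 / 2 := by gcongr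
      linarith
    have t2 := half_le_eulerK (F := F)
    have t3 := exp_neg_one_le_pow hq hl
    calc (8 * Real.exp 1)⁻¹ = 1 / 2 * (1 / 2 * (1 / 2) * Real.exp (-1)) := by
          rw [Real.exp_neg, mul_inv]; ring
      _ ≤ κ := by
        have : 0 ≤ 1 - 1 / q := by linarith
        have : 0 ≤ eulerK F := by linarith
        simp only [κ]
        gcongr
  have hκ0 : 0 < κ := lt_of_lt_of_le (by positivity) hκ
  have hG := inv_pow_le_rpow h0 hq hl
  refine ⟨(N - D * κ) / (D * κ), ?_, by field_simp; ring⟩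
  rw [abs_div, abs_of_pos (mul_pos hD0 hκ0), div_le_iff₀ (mul_pos hD0 hκ0)]
  refine key.trans ?_
  set A := Real.exp ((1 - 2 ^ (-ε))⁻¹ ^ 2)
  set G := ((1 - (2 : ℝ) ^ (-ε))⁻¹) ^ ((2 : ℝ) ^ (1 / ε)) with hGdef
  have hG0 : 0 < G := Real.rpow_pos_of_pos (inv_pos.2 (by linarith [two_rpow_neg_lt_one h0])) _
  set X := q ^ (-(1 - ε) * d₂ + ε * l) with hX
  set Y := q ^ (-(d₁ : ℝ) / 2 + l) with hY
  have eD : D = q ^ ((d₁ : ℝ) - l + d₂) := by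
    rw [hD, ← Real.rpow_intCast]; congr 1; push_cast; ring
  have e1 : q ^ (d₂ + (d₁ : ℝ) / 2) = D * Y := by
    rw [eD, hY, ← Real.rpow_add hq0]; congr 1; ring
  have e2 : q ^ ((d₁ : ℤ) - l) * (q ^ (ε * d₂) * q ^ (ε * l)) = D * X := by
    rw [eD, hX, ← Real.rpow_intCast, ← Real.rpow_add hq0, ← Real.rpow_add hq0, ← Real.rpow_add hq0]
    congr 1; push_cast; ring
  have hX0 : 0 < X := by positivity
  have hY0 : 0 < Y := by positivity
  have hA0 : 0 < A := Real.exp_pos _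
  calc 24 * q ^ (d₂ + (d₁ : ℝ) / 2) + q ^ ((d₁ : ℤ) - l) * (q ^ (ε * d₂) * (((1 - q ^ (-ε))⁻¹) ^ l * A))
      ≤ 24 * q ^ (d₂ + (d₁ : ℝ) / 2) + q ^ ((d₁ : ℤ) - l) * (q ^ (ε * d₂) * ((G * q ^ (ε * l)) * A)) := by
        gcongr
    _ = D * (24 * Y + A * G * X) := by rw [e1, mul_add, ← mul_left_comm (A * G), ← e2]; ring
    _ ≤ D * ((24 + A * G) * (X + Y)) := by
        refine mul_le_mul_of_nonneg_left ?_ hD0.le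
        nlinarith [mul_pos (mul_pos hA0 hG0) hY0]
    _ = (24 + A * G) * (X + Y) * D * 1 := by ring
    _ ≤ (24 + A * G) * (X + Y) * D * (8 * Real.exp 1 * κ) := by
        refine mul_le_mul_of_nonneg_left ?_ (by positivity)
        have := mul_le_mul_of_nonneg_left hκ (show 0 ≤ 8 * Real.exp 1 by positivity)
        rwa [mul_inv_cancel₀ (by positivity)] at this
    _ = _ := by rw [errorConstant]; ring

end Assembly

/-- The constant `C` depends on `ε` only; in particular it does not depend on the field. -/
theorem proposition4p3 (ε : ℝ) (hε₀ : 0 < ε) (hε₁ : ε < 1) :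
    ∃ C : ℝ, ∀ (F : Type*) [Field F] [Fintype F] (d₁ d₂ : ℕ),
      (∀ (l : ℕ) (x a : Fin l → F), Function.Injective x → (∀ i, a i ≠ 0) →
        ∃ E : ℝ,
          |E| ≤ C * ((Fintype.card F : ℝ) ^ (-(1 - ε) * d₂ + ε * l)
            + (Fintype.card F : ℝ) ^ (-(d₁ : ℝ) / 2 + l)) ∧
          (Set.ncard {f ∈ cubeFreeSet F d₁ d₂ | ∀ i, f.eval (x i) = a i} : ℝ) =
            eulerK F * (Fintype.card F : ℝ) ^ (d₁ + d₂) / polyZeta F 2 ^ 2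
              * ((Fintype.card F : ℝ)
                / (((Fintype.card F : ℝ) + 2) * ((Fintype.card F : ℝ) - 1))) ^ l
              * (1 + E)) ∧
      (∃ E : ℝ,
        |E| ≤ C * ((Fintype.card F : ℝ) ^ (-(1 - ε) * d₂)
          + (Fintype.card F : ℝ) ^ (-(d₁ : ℝ) / 2)) ∧
        (Set.ncard (cubeFreeSet F d₁ d₂) : ℝ) =
          eulerK F * (Fintype.card F : ℝ) ^ (d₁ + d₂) / polyZeta F 2 ^ 2 * (1 + E)) := by
  refine ⟨errorConstant ε, fun F _ _ d₁ d₂ =>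
    ⟨fun l x a hx ha => exists_relative_error hx ha d₁ d₂ hε₀ hε₁.le, ?_⟩⟩
  -- The unrestricted count is the case `l = 0`.
  have h := exists_relative_error (F := F) (x := (Fin.elim0 : Fin 0 → F)) (fun i => i.elim0)
    (a := Fin.elim0) (fun i => i.elim0) d₁ d₂ hε₀ hε₁.le
  simpa using h
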